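/- Let $k,n\ge 0$ be integers and let $F$ be a germ of a holomorphic function at a point $p\in\mathbb C^k$ which has an isolated critical point at $p$. Let $\mathcal O_p$ be the algebra of germs of holomorphic functions at $p$, let $$A=A_{p,F}=\mathcal O_p\big/\big(\partial F/\partial t_1,\dots,\partial F/\partial t_k\big)$$ be the local algebra, $\mathfrak m_p$ its maximal ideal, $\mu=\dim_{\mathbb C}A$ the Milnor number, $f(p)\in A/\mathfrak m_p=\mathbb C$ the value of $f\in A$ at $p$, $[\mathrm{Hess}\,F]\in A$ the class of $\det(\partial^2F/\partial t_l\partial t_m)_{1\le l,m\le k}$, and $(f,g)_p=\rho_p(fg)$ the residue bilinear form on $A$, where $\rho_p:A\to\mathbb C$ is the Grothendieck residue $$\rho_p(f)=\mathrm{Res}_p\left[\frac{f\,dt_1\wedge\dots\wedge dt_k}{\partial F/\partial t_1,\ \dots,\ \partial F/\partial t_k}\right].$$ Let $h_1,\dots,h_\mu$ be a basis of $A$ and let $g_1,\dots,g_n\in A$ generate $A$ as a unital algebra. Let $W$ be a complex vector space with a symmetric bilinear form $S$, and let $M_1,\dots,M_n:W\to W$ be linear operators with $M_iM_j=M_jM_i$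 and $S(M_ju,v)=S(u,M_jv)$ for all $i,j$ and all $u,v\in W$. Let $w=\sum_{l=1}^{\mu}h_l\otimes w_l\in A\otimes W$ be such that $$\sum_{l}h_l\otimes M_jw_l=\sum_{l}g_jh_l\otimes w_l\quad(j=1,\dots,n),\qquad \sum_{l,m}S(w_l,w_m)\,h_lh_m=(-1)^k[\mathrm{Hess}\,F].$$ Let $Y\subset W$ be the span of $w_1,\dots,w_\mu$, and let $\alpha:A\to Y$, $\alpha(f)=\sum_{l}(f,h_l)_p\,w_l$. Then every $M_j$ preserves $Y$; let $A_Y\subset\mathrm{End}(Y)$ be the unital subalgebra generated by the operators $M_j|_Y$, $j=1,\dots,n$. Moreover: (i) $\alpha:A\to Y$ is an isomorphism of vector spaces, and the restriction of $S$ to $Y$ is nondegenerate. (ii) There is an algebra isomorphism $\beta:A\to A_Y$ with $\beta(g_j)=M_j|_Y$ for all $j$, and it is the only algebra homomorphism $A\to A_Y$ with this property. (iii) The maps $\alpha,\beta$ identify the regular representation of $A$ with the $A_Y$-module $Y$: $\beta(f)\alpha(f')=\alpha(ff')$ for all $f,f'\in A$; in particular $M_j\alpha(f)=\alpha(g_jf)$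 for all $j$ and $f$. (iv) Let $w(p)=\sum_l h_l(p)w_l\in W$ be the image of $w$ under $A\otimes W\to A/\mathfrak m_p\otimes W=W$. Then $w(p)=\alpha([\mathrm{Hess}\,F])/\mu$, $w(p)\ne 0$, $M_jw(p)=g_j(p)\,w(p)$ for all $j$, and every common eigenvector in $Y$ of the operators $M_j|_Y$, $j=1,\dots,n$, is proportional to $w(p)$. -/

import Mathlib

open Filter Topology TensorProduct

noncomputable section

namespace CriticalPoint

/-! ### Germs of holomorphic functions at a point of `ℂᵏ` -/

/-- The pointwise `ℂ`-algebra structure on germs of complex valued functions. -/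
instance germAlgebra {X : Type*} (l : Filter X) : Algebra ℂ (Germ l ℂ) :=
  Algebra.ofModule
    (fun r x y => by
      induction x using Germ.inductionOn
      induction y using Germ.inductionOn
      rw [← Germ.coe_smul, ← Germ.coe_mul, ← Germ.coe_mul, ← Germ.coe_smul, smul_mul_assoc])
    (fun r x y => by
      induction x using Germ.inductionOn
      induction y using Germ.inductionOn
      rw [← Germ.coe_smul, ← Germ.coe_mul, ← Germ.coe_mul, ← Germ.coe_smul, mul_smul_comm])

theorem algebraMap_germ {X : Type*} (l : Filter X) (c : ℂ) :
    algebraMap ℂ (Germ l ℂ) c = ((fun _ => c : X → ℂ) : Germ l ℂ) := by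
  rw [Algebra.algebraMap_eq_smul_one, ← Germ.coe_one, ← Germ.coe_smul]
  congr 1
  funext x
  simp

/-- The algebra `𝒪_p` of germs at `p` of holomorphic functions. -/
def HolGerm {k : ℕ} (p : Fin k → ℂ) : Subalgebra ℂ (Germ (𝓝 p) ℂ) where
  carrier := {φ | ∃ f : (Fin k → ℂ) → ℂ, AnalyticAt ℂ f p ∧ φ = (f : Germ (𝓝 p) ℂ)}
  mul_mem' := by
    rintro _ _ ⟨f, hf, rfl⟩ ⟨g, hg, rfl⟩
    exact ⟨f * g, hf.mul hg, rfl⟩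
  add_mem' := by
    rintro _ _ ⟨f, hf, rfl⟩ ⟨g, hg, rfl⟩
    exact ⟨f + g, hf.add hg, rfl⟩
  algebraMap_mem' c := ⟨fun _ => c, analyticAt_const, algebraMap_germ _ c⟩

variable {k : ℕ} {p : Fin k → ℂ}

/-- The germ at `p` of a function that is holomorphic near `p`. -/
def toGerm {F : (Fin k → ℂ) → ℂ} (hF : AnalyticAt ℂ F p) : HolGerm p :=
  ⟨(F : Germ (𝓝 p) ℂ), F, hF, rfl⟩

theorem exists_toGerm (φ : HolGerm p) :
    ∃ (f : (Fin k → ℂ) → ℂ) (hf : AnalyticAt ℂ f p), φ = toGerm hf := by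
  obtain ⟨_, f, hf, rfl⟩ := φ
  exact ⟨f, hf, rfl⟩

/-- The value `φ ↦ φ(p)` of a germ at `p`. -/
def evalGerm (p : Fin k → ℂ) : HolGerm p →ₐ[ℂ] ℂ where
  toFun φ := Germ.value φ.1
  map_one' := rfl
  map_zero' := rfl
  map_mul' := by
    rintro ⟨_, f, hf, rfl⟩ ⟨_, g, hg, rfl⟩
    rfl
  map_add' := by
    rintro ⟨_, f, hf, rfl⟩ ⟨_, g, hg, rfl⟩
    rfl
  commutes' c := by
    change Germ.value (algebraMap ℂ (Germ (𝓝 p) ℂ) c) = c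
    rw [algebraMap_germ]
    rfl

/-- The partial derivative `∂f/∂tᵢ` of a function on `ℂᵏ`. -/
def partialFun (i : Fin k) (f : (Fin k → ℂ) → ℂ) : (Fin k → ℂ) → ℂ :=
  fun t => fderiv ℂ f t (Pi.single i 1)

theorem analyticAt_partialFun (i : Fin k) {f : (Fin k → ℂ) → ℂ} (hf : AnalyticAt ℂ f p) :
    AnalyticAt ℂ (partialFun i f) p :=
  ((ContinuousLinearMap.apply ℂ ℂ (Pi.single i 1 : Fin k → ℂ)).analyticAt _).comp hf.fderiv

theorem partialFun_congr (i : Fin k) {f g : (Fin k → ℂ) → ℂ} (h : f =ᶠ[𝓝 p] g) :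
    partialFun i f =ᶠ[𝓝 p] partialFun i g := by
  filter_upwards [h.fderiv (𝕜 := ℂ)] with t ht
  simp only [partialFun, ht]

/-- The partial derivative `∂/∂tᵢ` on germs, on underlying elements. -/
def partialGermFun (i : Fin k) (φ : HolGerm p) : HolGerm p :=
  ⟨Germ.map' (partialFun i) (fun _ _ h => partialFun_congr i h) φ.1, by
    obtain ⟨_, f, hf, rfl⟩ := φ
    exact ⟨partialFun i f, analyticAt_partialFun i hf, rfl⟩⟩

theorem partialGermFun_toGerm (i : Fin k) {f : (Fin k → ℂ) → ℂ} (hf : AnalyticAt ℂ f p) :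
    partialGermFun i (toGerm hf) = toGerm (analyticAt_partialFun i hf) := rfl

theorem toGerm_congr {f g : (Fin k → ℂ) → ℂ} (hf : AnalyticAt ℂ f p) (hg : AnalyticAt ℂ g p)
    (h : f =ᶠ[𝓝 p] g) : toGerm hf = toGerm hg :=
  Subtype.ext (Germ.coe_eq.mpr h)

/-- The derivation `∂/∂tᵢ` of `𝒪_p`. -/
def pderiv (i : Fin k) : Derivation ℂ (HolGerm p) (HolGerm p) :=
  Derivation.mk'
    { toFun := partialGermFun i
      map_add' := by
        intro φ ψ
        obtain ⟨f, hf, rfl⟩ := exists_toGerm φ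
        obtain ⟨g, hg, rfl⟩ := exists_toGerm ψ
        change toGerm (analyticAt_partialFun i (hf.add hg)) =
          toGerm ((analyticAt_partialFun i hf).add (analyticAt_partialFun i hg))
        apply toGerm_congr
        filter_upwards [hf.eventually_analyticAt, hg.eventually_analyticAt] with t h1 h2
        simp [partialFun, fderiv_add h1.differentiableAt h2.differentiableAt]
      map_smul' := by
        intro c φ
        obtain ⟨f, hf, rfl⟩ := exists_toGerm φ
        change toGerm (analyticAt_partialFun i (hf.const_smul (c := c))) =
          toGerm ((analyticAt_partialFun i hf).const_smul (c := c))
        apply toGerm_congr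
        filter_upwards [hf.eventually_analyticAt] with t h1
        simp [partialFun, fderiv_const_smul h1.differentiableAt] }
    (by
      intro φ ψ
      obtain ⟨f, hf, rfl⟩ := exists_toGerm φ
      obtain ⟨g, hg, rfl⟩ := exists_toGerm ψ
      change toGerm (analyticAt_partialFun i (hf.mul hg)) =
        toGerm ((hf.mul (analyticAt_partialFun i hg)).add (hg.mul (analyticAt_partialFun i hf)))
      apply toGerm_congr
      filter_upwards [hf.eventually_analyticAt, hg.eventually_analyticAt] with t h1 h2
      simp [partialFun, fderiv_mul h1.differentiableAt h2.differentiableAt])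

/-- The linear operator underlying the derivation `∂/∂tᵢ`. -/
abbrev pderivEnd (p : Fin k → ℂ) (i : Fin k) : Module.End ℂ (HolGerm p) :=
  (pderiv (p := p) i).toLinearMap

theorem pderiv_toGerm (i : Fin k) {f : (Fin k → ℂ) → ℂ} (hf : AnalyticAt ℂ f p) :
    pderiv i (toGerm hf) = toGerm (analyticAt_partialFun i hf) := rfl

theorem analyticAt_coord (p : Fin k → ℂ) (i : Fin k) :
    AnalyticAt ℂ (fun t : Fin k → ℂ => t i - p i) p :=
  ((ContinuousLinearMap.proj (R := ℂ) (φ := fun _ : Fin k => ℂ) i).analyticAt p).sub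
    analyticAt_const

/-- The germ of the coordinate function `tᵢ - pᵢ`. -/
def coord (p : Fin k → ℂ) (i : Fin k) : HolGerm p := toGerm (analyticAt_coord p i)

theorem pderiv_coord (i j : Fin k) :
    pderiv i (coord p j) = if i = j then 1 else 0 := by
  have key : pderiv i (coord p j) =
      toGerm (p := p) (F := fun _ => if i = j then 1 else 0) analyticAt_const := by
    rw [coord, pderiv_toGerm]
    apply toGerm_congr
    refine Eventually.of_forall fun t => ?_
    have h : HasFDerivAt (fun t : Fin k → ℂ => t j - p j)
        (ContinuousLinearMap.proj (R := ℂ) (φ := fun _ : Fin k => ℂ) j) t :=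
      ((ContinuousLinearMap.proj (R := ℂ) (φ := fun _ : Fin k => ℂ) j).hasFDerivAt).sub_const _
    simp [partialFun, h.fderiv, Pi.single_apply, eq_comm]
  rw [key]
  split_ifs <;> rfl

/-! ### Taylor coefficients -/

/-- The differential operator `∏ᵢ (∂/∂tᵢ)^{αᵢ}`, the product taken over the indices in `l`. -/
def mixedDeriv (α : Fin k → ℕ) (l : List (Fin k)) : Module.End ℂ (HolGerm p) :=
  (l.map fun i => pderivEnd p i ^ α i).prod

/-- The coefficient of `∏ᵢ (tᵢ - pᵢ)^{αᵢ}` in the Taylor expansion of a germ at `p`,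
that is `(∏ᵢ αᵢ!)⁻¹ (∂^α φ)(p)`. -/
def taylorCoeff (p : Fin k → ℂ) (α : Fin k → ℕ) : HolGerm p →ₗ[ℂ] ℂ :=
  (∏ i, ((α i).factorial : ℂ))⁻¹ •
    ((evalGerm p).toLinearMap ∘ₗ mixedDeriv α (List.finRange k))

theorem pderiv_mem_span (i j : Fin k) (m : ℕ) (φ : HolGerm p)
    (h : φ ∈ Ideal.span {coord p i ^ (m + 1)}) :
    pderiv j φ ∈ Ideal.span {coord p i ^ (if j = i then m else m + 1)} := by
  obtain ⟨q, rfl⟩ := Ideal.mem_span_singleton'.mp h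
  rw [Derivation.leibniz, Derivation.leibniz_pow, pderiv_coord]
  refine Ideal.mem_span_singleton.mpr ?_
  split_ifs with hji
  · simp only [smul_eq_mul, nsmul_eq_mul, Nat.add_sub_cancel, mul_one]
    exact dvd_add (Dvd.dvd.mul_left (Dvd.intro_left _ rfl) _)
      (Dvd.dvd.mul_right (pow_dvd_pow _ (Nat.le_succ m)) _)
  · simp only [smul_eq_mul, mul_zero, smul_zero, zero_add]
    exact Dvd.intro _ rfl

theorem pderiv_pow_mem_span (i j : Fin k) (a m : ℕ) (φ : HolGerm p)
    (h : φ ∈ Ideal.span {coord p i ^ (m + 1 + if j = i then a else 0)}) :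
    (pderivEnd p j ^ a) φ ∈
      Ideal.span {coord p i ^ (m + 1)} := by
  induction a generalizing φ with
  | zero => simpa using h
  | succ a ih =>
    rw [pow_succ]
    refine ih _ ?_
    by_cases hji : j = i
    · have := pderiv_mem_span i j (m + 1 + a) φ (by simpa [hji, add_assoc] using h)
      simpa [hji] using this
    · have := pderiv_mem_span i j m φ (by simpa [hji] using h)
      simpa [hji] using this

theorem mixedDeriv_mem_span (i : Fin k) (α : Fin k → ℕ) (l : List (Fin k)) (m : ℕ)
    (φ : HolGerm p) (h : φ ∈ Ideal.span {coord p i ^ (m + 1 + l.count i * α i)}) :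
    mixedDeriv α l φ ∈ Ideal.span {coord p i ^ (m + 1)} := by
  induction l generalizing m with
  | nil => simpa [mixedDeriv] using h
  | cons j l ih =>
    have hcons : mixedDeriv (p := p) α (j :: l) =
        pderivEnd p j ^ α j *
          mixedDeriv α l := by simp [mixedDeriv]
    rw [hcons, Module.End.mul_apply]
    refine pderiv_pow_mem_span i j (α j) m _ ?_
    have hm : m + 1 + (if j = i then α j else 0) = (m + if j = i then α j else 0) + 1 := by
      omega
    rw [hm]
    refine ih _ ?_
    convert h using 4
    rw [List.count_cons]
    by_cases hji : j = i
    · subst hji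
      simp
      ring
    · simp [hji]

theorem taylorCoeff_eq_zero (α : Fin k → ℕ) (i : Fin k) (φ : HolGerm p)
    (h : φ ∈ Ideal.span {coord p i ^ (α i + 1)}) : taylorCoeff p α φ = 0 := by
  have hcount : (List.finRange k).count i = 1 :=
    List.count_eq_one_of_mem (List.nodup_finRange k) (List.mem_finRange i)
  have := mixedDeriv_mem_span i α (List.finRange k) 0 φ (by
    rw [hcount]
    convert h using 4
    ring)
  obtain ⟨q, hq⟩ := Ideal.mem_span_singleton'.mp this
  have hc : evalGerm p (coord p i) = 0 := by
    change p i - p i = 0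
    simp
  simp [taylorCoeff, ← hq, hc]

theorem pderiv_coord_mul (i j : Fin k) (φ : HolGerm p) :
    pderiv j (coord p i * φ) = coord p i * pderiv j φ + if j = i then φ else 0 := by
  rw [Derivation.leibniz, pderiv_coord]
  split_ifs <;> simp

theorem pderiv_pow_coord_mul_of_ne (i j : Fin k) (hji : j ≠ i) (a : ℕ) (φ : HolGerm p) :
    (pderivEnd p j ^ a) (coord p i * φ) = coord p i * (pderivEnd p j ^ a) φ := by
  induction a with
  | zero => rfl
  | succ a ih =>
    rw [pow_succ', Module.End.mul_apply, Module.End.mul_apply, ih]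
    have := pderiv_coord_mul i j ((pderivEnd p j ^ a) φ)
    rw [if_neg hji, add_zero] at this
    exact this

theorem pderiv_pow_coord_mul_self (i : Fin k) (a : ℕ) (φ : HolGerm p) :
    (pderivEnd p i ^ (a + 1)) (coord p i * φ) =
      coord p i * (pderivEnd p i ^ (a + 1)) φ + ((a : ℂ) + 1) • (pderivEnd p i ^ a) φ := by
  induction a with
  | zero =>
    have := pderiv_coord_mul i i φ
    rw [if_pos rfl] at this
    simpa using this
  | succ a ih =>
    rw [pow_succ', Module.End.mul_apply, ih, map_add, map_smul]
    have := pderiv_coord_mul i i ((pderivEnd p i ^ (a + 1)) φ)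
    rw [if_pos rfl] at this
    change pderiv i (coord p i * _) + _ = _
    rw [this, ← Module.End.mul_apply, ← pow_succ' (pderivEnd p i) a, add_assoc]
    congr 1
    push_cast
    rw [add_smul ((a : ℂ) + 1), one_smul, add_comm]

theorem mixedDeriv_cons (α : Fin k → ℕ) (j : Fin k) (l : List (Fin k)) (φ : HolGerm p) :
    mixedDeriv α (j :: l) φ = (pderivEnd p j ^ α j) (mixedDeriv α l φ) := by
  simp [mixedDeriv]

theorem mixedDeriv_coord_mul (i : Fin k) (α : Fin k → ℕ) (l : List (Fin k)) (hl : l.Nodup)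
    (φ : HolGerm p) :
    mixedDeriv (α + Pi.single i 1) l (coord p i * φ) =
      coord p i * mixedDeriv (α + Pi.single i 1) l φ +
        if i ∈ l then ((α i : ℂ) + 1) • mixedDeriv α l φ else 0 := by
  induction l with
  | nil => simp [mixedDeriv]
  | cons j l ih =>
    rw [List.nodup_cons] at hl
    rw [mixedDeriv_cons, mixedDeriv_cons, mixedDeriv_cons, ih hl.2]
    by_cases hji : j = i
    · subst hji
      have hl' : mixedDeriv (p := p) (α + Pi.single j 1) l = mixedDeriv α l := by
        unfold mixedDeriv
        congr 1
        refine List.map_congr_left fun b hb => ?_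
        have : b ≠ j := fun h => hl.1 (h ▸ hb)
        simp [this]
      rw [if_neg hl.1, add_zero, if_pos (by simp), hl']
      have := pderiv_pow_coord_mul_self j (α j) (mixedDeriv α l φ)
      simpa using this
    · have hα : (α + Pi.single i 1 : Fin k → ℕ) j = α j := by simp [hji]
      have hmem : i ∈ j :: l ↔ i ∈ l := by simp [Ne.symm hji]
      rw [hα, map_add, pderiv_pow_coord_mul_of_ne i j hji]
      congr 1
      simp only [hmem]
      split_ifs <;> simp

theorem taylorCoeff_coord_mul (i : Fin k) (α : Fin k → ℕ) (φ : HolGerm p) :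
    taylorCoeff p (α + Pi.single i 1) (coord p i * φ) = taylorCoeff p α φ := by
  have hc : evalGerm p (coord p i) = 0 := by
    change p i - p i = 0
    simp
  have hprod : (∏ j, (((α + Pi.single i 1 : Fin k → ℕ) j).factorial : ℂ)) =
      ((α i : ℂ) + 1) * ∏ j, ((α j).factorial : ℂ) := by
    rw [← Finset.mul_prod_erase _ _ (Finset.mem_univ i),
      ← Finset.mul_prod_erase (a := i) _ (fun j => ((α j).factorial : ℂ)) (Finset.mem_univ i),
      ← mul_assoc]
    congr 1
    · simp [Nat.factorial_succ]
    · refine Finset.prod_congr rfl fun j hj => ?_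
      simp [Finset.ne_of_mem_erase hj]
  have hi : ((α i : ℂ) + 1) ≠ 0 := by exact_mod_cast Nat.succ_ne_zero (α i)
  simp only [taylorCoeff, LinearMap.smul_apply, LinearMap.comp_apply, AlgHom.toLinearMap_apply,
    smul_eq_mul]
  rw [mixedDeriv_coord_mul i α _ (List.nodup_finRange k), if_pos (List.mem_finRange i), hprod,
    map_add, map_mul, hc, zero_mul, zero_add, map_smul, smul_eq_mul, mul_inv]
  field_simp

theorem taylorCoeff_coord_pow_mul (i : Fin k) (α : Fin k → ℕ) (m : ℕ) (φ : HolGerm p) :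
    taylorCoeff p (α + Pi.single i m) (coord p i ^ m * φ) = taylorCoeff p α φ := by
  induction m with
  | zero => simp
  | succ m ih =>
    rw [Pi.single_add, ← add_assoc, pow_succ', mul_assoc, taylorCoeff_coord_mul, ih]

theorem taylorCoeff_prod_coord_pow_mul (α : Fin k → ℕ) (m : ℕ) (φ : HolGerm p) :
    taylorCoeff p (fun i => α i + m) ((∏ i, coord p i ^ m) * φ) = taylorCoeff p α φ := by
  have key : ∀ s : Finset (Fin k),
      taylorCoeff p (α + ∑ i ∈ s, Pi.single i m) ((∏ i ∈ s, coord p i ^ m) * φ) =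
        taylorCoeff p α φ := by
    intro s
    induction s using Finset.induction_on with
    | empty => simp
    | insert i s hi ih =>
      rw [Finset.sum_insert hi, Finset.prod_insert hi, add_comm (Pi.single i m : Fin k → ℕ),
        ← add_assoc, mul_assoc, taylorCoeff_coord_pow_mul, ih]
  have h := key Finset.univ
  rw [Finset.univ_sum_single (fun _ : Fin k => m)] at h
  exact h

/-! ### The Grothendieck residue -/

/-- `x_i^{N+1} = ∑ⱼ C i j * f j` for all `i`, where `x_i = t_i - p_i`. -/
def IsResidueDatum (f : Fin k → HolGerm p) (N : ℕ) (C : Matrix (Fin k) (Fin k) (HolGerm p)) :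
    Prop :=
  ∀ i, coord p i ^ (N + 1) = ∑ j, C i j * f j

theorem IsResidueDatum.shift {f : Fin k → HolGerm p} {N : ℕ}
    {C : Matrix (Fin k) (Fin k) (HolGerm p)} (hC : IsResidueDatum f N C) (m : ℕ) :
    IsResidueDatum f (N + m) (Matrix.of fun i j => coord p i ^ m * C i j) := by
  intro i
  have : N + m + 1 = m + (N + 1) := by ring
  rw [this, pow_add, hC i, Finset.mul_sum]
  exact Finset.sum_congr rfl fun j _ => by simp [mul_assoc]

theorem taylorCoeff_det_shift (N m : ℕ) (C : Matrix (Fin k) (Fin k) (HolGerm p))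
    (φ : HolGerm p) :
    taylorCoeff p (fun _ => N + m) ((Matrix.of fun i j => coord p i ^ m * C i j).det * φ) =
      taylorCoeff p (fun _ => N) (C.det * φ) := by
  rw [Matrix.det_mul_column, mul_assoc]
  exact taylorCoeff_prod_coord_pow_mul (fun _ => N) m _

theorem taylorCoeff_det_eq_zero {f : Fin k → HolGerm p} {N : ℕ} (i : Fin k)
    {D : Matrix (Fin k) (Fin k) (HolGerm p)} (hi : ∑ j, D i j * f j = 0)
    (hD : ∀ l, l ≠ i → coord p l ^ (N + 1) = ∑ j, D l j * f j)
    (hf : ∃ c : Fin k → HolGerm p, coord p i ^ (N + 1) = ∑ j, c j * f j) (φ : HolGerm p) :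
    taylorCoeff p (fun _ => N) (D.det * φ) = 0 := by
  have hz : ∀ l q,
      taylorCoeff p ((fun _ => N) + Pi.single i (N + 1)) (q * (D.det * f l)) = 0 := by
    intro l q
    have hvec : D.det • f = D.adjugate.mulVec (D.mulVec f) := by
      rw [Matrix.mulVec_mulVec, Matrix.adjugate_mul, Matrix.smul_mulVec, Matrix.one_mulVec]
    have hl : D.det * f l = ∑ j, D.adjugate l j * D.mulVec f j := congrFun hvec l
    rw [hl, Finset.mul_sum, map_sum]
    refine Finset.sum_eq_zero fun j _ => ?_
    by_cases hj : j = i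
    · have : D.mulVec f j = 0 := by rw [hj]; exact hi
      simp [this]
    · have : D.mulVec f j = coord p j ^ (N + 1) := (hD j hj).symm
      rw [this, ← mul_assoc]
      refine taylorCoeff_eq_zero _ j _ (Ideal.mem_span_singleton'.mpr ⟨q * D.adjugate l j, ?_⟩)
      simp [hj]
  obtain ⟨c, hc⟩ := hf
  rw [← taylorCoeff_coord_pow_mul i (fun _ => N) (N + 1), hc, Finset.sum_mul, map_sum]
  refine Finset.sum_eq_zero fun l _ => ?_
  rw [← hz l (c l * φ)]
  congr 1
  ring

/-- The coefficient that defines the residue does not depend on `C`. -/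
theorem IsResidueDatum.taylorCoeff_eq {f : Fin k → HolGerm p} {N : ℕ}
    {C C' : Matrix (Fin k) (Fin k) (HolGerm p)} (hC : IsResidueDatum f N C)
    (hC' : IsResidueDatum f N C') (φ : HolGerm p) :
    taylorCoeff p (fun _ => N) (C.det * φ) = taylorCoeff p (fun _ => N) (C'.det * φ) := by
  classical
  have key : ∀ s : Finset (Fin k),
      taylorCoeff p (fun _ => N) ((Matrix.of fun i => if i ∈ s then C' i else C i).det * φ) =
        taylorCoeff p (fun _ => N) (C.det * φ) := by
    intro s
    induction s using Finset.induction_on with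
    | empty =>
      congr 3
    | insert i s hi ih =>
      rw [← ih, ← sub_eq_zero, ← map_sub, ← sub_mul]
      set B : Matrix (Fin k) (Fin k) (HolGerm p) :=
        Matrix.of fun i => if i ∈ s then C' i else C i with hB
      have h1 : (Matrix.of fun j => if j ∈ insert i s then C' j else C j) =
          B.updateRow i (C' i) := by
        ext a b
        by_cases ha : a = i
        · subst ha
          simp
        · simp [hB, ha]
      have h2 : B = B.updateRow i (C i) := by
        ext a b
        by_cases ha : a = i
        · subst ha
          simp [hB, hi]
        · simp [ha]
      have h3 : (B.updateRow i (C' i)).det - B.det = (B.updateRow i (C' i - C i)).det := by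
        have := Matrix.det_updateRow_add B i (C' i - C i) (C i)
        rw [sub_add_cancel, ← h2] at this
        rw [this, add_sub_cancel_right]
      rw [h1, h3]
      refine taylorCoeff_det_eq_zero (f := f) i ?_ ?_ ?_ φ
      · simp [sub_mul, Finset.sum_sub_distrib, ← hC i, ← hC' i]
      · intro l hl
        by_cases hs : l ∈ s
        · simpa [hl, hB, hs] using hC' l
        · simpa [hl, hB, hs] using hC l
      · exact ⟨C i, hC i⟩
  have h := key Finset.univ
  rw [← h]
  congr 3
  ext a b
  simp

open Classical in
/-- The Grothendieck residue symbol
`Res_p [φ dt₁ ∧ ⋯ ∧ dt_k / (f₁, …, f_k)]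
  = (2πi)^{-k} ∫_{|f₁| = ε₁, …, |f_k| = ε_k} φ dt₁ ∧ ⋯ ∧ dt_k / (f₁ ⋯ f_k)`
of germs `f₁, …, f_k` whose only common zero near `p` is `p`. It is given through the
transformation law: some powers `x_i^{N+1}` of the local coordinates `x_i = t_i - p_i` lie in
the ideal `(f₁, …, f_k)`, and if `x_i^{N+1} = ∑ⱼ C i j * f j`, then
`Res_p [φ dt / (f₁, …, f_k)] = Res_p [det C · φ dt / (x₁^{N+1}, …, x_k^{N+1})]`,
which by Cauchy's formula is the coefficient of `x₁^N ⋯ x_k^N` in the Taylor expansion of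
`det C · φ`. The value does not depend on the choice of `N` and `C` (`residueGerm_eq`). -/
def residueGerm (f : Fin k → HolGerm p) : HolGerm p →ₗ[ℂ] ℂ :=
  if h : ∃ d : ℕ × Matrix (Fin k) (Fin k) (HolGerm p), IsResidueDatum f d.1 d.2 then
    taylorCoeff p (fun _ => h.choose.1) ∘ₗ LinearMap.mulLeft ℂ h.choose.2.det
  else 0

/-- The residue can be computed from any `N` and `C`. -/
theorem residueGerm_eq {f : Fin k → HolGerm p} {N : ℕ}
    {C : Matrix (Fin k) (Fin k) (HolGerm p)} (hC : IsResidueDatum f N C) (φ : HolGerm p) :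
    residueGerm f φ = taylorCoeff p (fun _ => N) (C.det * φ) := by
  have h : ∃ d : ℕ × Matrix (Fin k) (Fin k) (HolGerm p), IsResidueDatum f d.1 d.2 :=
    ⟨(N, C), hC⟩
  have hd : IsResidueDatum f h.choose.1 h.choose.2 := h.choose_spec
  rw [residueGerm, dif_pos h, LinearMap.comp_apply, LinearMap.mulLeft_apply,
    ← taylorCoeff_det_shift h.choose.1 N, ← taylorCoeff_det_shift N h.choose.1 C]
  have h2 := hC.shift h.choose.1
  have h1 := hd.shift N
  rw [add_comm] at h2
  rw [add_comm N]
  exact h1.taylorCoeff_eq h2 φ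

theorem residueGerm_eq_zero (f : Fin k → HolGerm p) (φ : HolGerm p)
    (hφ : φ ∈ Ideal.span (Set.range f)) : residueGerm f φ = 0 := by
  unfold residueGerm
  split_ifs with h
  · set d := h.choose with hd
    have hC : IsResidueDatum f d.1 d.2 := h.choose_spec
    refine Submodule.span_induction (p := fun φ _ => ∀ q : HolGerm p,
      (taylorCoeff p (fun _ => d.1) ∘ₗ LinearMap.mulLeft ℂ d.2.det) (q * φ) = 0)
      ?_ ?_ ?_ ?_ hφ 1 |> fun H => by simpa using H
    · rintro _ ⟨j, rfl⟩ q
      have hvec : d.2.det • f = d.2.adjugate.mulVec (fun i => coord p i ^ (d.1 + 1)) := by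
        have : (fun i => coord p i ^ (d.1 + 1)) = d.2.mulVec f := funext hC
        rw [this, Matrix.mulVec_mulVec, Matrix.adjugate_mul, Matrix.smul_mulVec,
          Matrix.one_mulVec]
      have hj : d.2.det * f j = ∑ i, d.2.adjugate j i * coord p i ^ (d.1 + 1) :=
        congrFun hvec j
      have : d.2.det * (q * f j) = ∑ i, q * d.2.adjugate j i * coord p i ^ (d.1 + 1) := by
        rw [mul_left_comm, hj, Finset.mul_sum]
        exact Finset.sum_congr rfl fun i _ => by ring
      simp only [LinearMap.comp_apply, LinearMap.mulLeft_apply, this, map_sum]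
      exact Finset.sum_eq_zero fun i _ =>
        taylorCoeff_eq_zero _ i _ (Ideal.mem_span_singleton'.mpr ⟨_, rfl⟩)
    · intro q
      simp
    · intro x y _ _ hx hy q
      rw [mul_add, map_add, hx, hy, add_zero]
    · intro a x _ hx q
      rw [smul_eq_mul, ← mul_assoc]
      exact hx (q * a)
  · rfl

/-- The Grothendieck residue as a linear function on `𝒪_p / (f₁, …, f_k)`. -/
def residue (f : Fin k → HolGerm p) : (HolGerm p ⧸ Ideal.span (Set.range f)) →ₗ[ℂ] ℂ :=
  ((Ideal.span (Set.range f)).restrictScalars ℂ).liftQ (residueGerm f)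
      (fun φ hφ => residueGerm_eq_zero f φ hφ) ∘ₗ
    (Submodule.Quotient.restrictScalarsEquiv ℂ (Ideal.span (Set.range f))).symm.toLinearMap

theorem residue_mk (f : Fin k → HolGerm p) (φ : HolGerm p) :
    residue f (Ideal.Quotient.mk _ φ) = residueGerm f φ := rfl

/-! ### The local algebra of a critical point -/

/-- `p` is a critical point of `F`, and `F` has no other critical points near `p`. -/
def IsIsolatedCriticalPoint (F : (Fin k → ℂ) → ℂ) (p : Fin k → ℂ) : Prop :=
  fderiv ℂ F p = 0 ∧ ∀ᶠ t in 𝓝[≠] p, fderiv ℂ F t ≠ 0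

section LocalAlgebra

variable {F : (Fin k → ℂ) → ℂ} (hF : AnalyticAt ℂ F p)

/-- The germs `∂F/∂t₁, …, ∂F/∂t_k`. -/
def gradGerm (i : Fin k) : HolGerm p := pderiv i (toGerm hF)

/-- The local algebra `A_{p,F} = 𝒪_p / (∂F/∂t₁, …, ∂F/∂t_k)`. -/
def LocalAlgebra : Type := HolGerm p ⧸ Ideal.span (Set.range (gradGerm hF))

instance : CommRing (LocalAlgebra hF) :=
  inferInstanceAs (CommRing (HolGerm p ⧸ Ideal.span (Set.range (gradGerm hF))))

instance : Algebra ℂ (LocalAlgebra hF) :=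
  inferInstanceAs (Algebra ℂ (HolGerm p ⧸ Ideal.span (Set.range (gradGerm hF))))

/-- The canonical projection `[ ] : 𝒪_p → A_{p,F}`. -/
def proj : HolGerm p →ₐ[ℂ] LocalAlgebra hF :=
  Ideal.Quotient.mkₐ ℂ (Ideal.span (Set.range (gradGerm hF)))

theorem proj_surjective : Function.Surjective (proj hF) :=
  Ideal.Quotient.mkₐ_surjective ℂ _

theorem proj_eq_zero_iff (φ : HolGerm p) :
    proj hF φ = 0 ↔ φ ∈ Ideal.span (Set.range (gradGerm hF)) :=
  Ideal.Quotient.eq_zero_iff_mem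

/-- The Milnor number `μ_p = dim A_{p,F}`. -/
def milnorNumber : ℕ := Module.finrank ℂ (LocalAlgebra hF)

/-- The class `[Hess F]` in `A_{p,F}` of the germ `det (∂²F/∂t_l∂t_m)`. -/
def hessClass : LocalAlgebra hF :=
  proj hF (Matrix.det (Matrix.of fun l m : Fin k => pderiv l (pderiv m (toGerm hF))))

/-- The residue functional `ρ_p : A_{p,F} → ℂ`, `[φ] ↦ Res_p [φ dt / (∂F/∂t₁, …, ∂F/∂t_k)]`. -/
def localResidue : LocalAlgebra hF →ₗ[ℂ] ℂ := residue (gradGerm hF)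

theorem localResidue_proj (φ : HolGerm p) :
    localResidue hF (proj hF φ) = residueGerm (gradGerm hF) φ := rfl

/-- The residue bilinear form `(f, g)_p = ρ_p (f g)`. -/
def residueForm : LinearMap.BilinForm ℂ (LocalAlgebra hF) :=
  (LinearMap.mul ℂ (LocalAlgebra hF)).compr₂ (localResidue hF)

theorem residueForm_apply (f g : LocalAlgebra hF) :
    residueForm hF f g = localResidue hF (f * g) := rfl

/-- The value at the critical point `p`, as a homomorphism `A_{p,F} → A_{p,F}/𝔪_p = ℂ`. -/
def evalAt (hp : IsIsolatedCriticalPoint F p) : LocalAlgebra hF →ₐ[ℂ] ℂ :=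
  Ideal.Quotient.liftₐ (Ideal.span (Set.range (gradGerm hF))) (evalGerm p) (by
    intro φ hφ
    have hle : Ideal.span (Set.range (gradGerm hF)) ≤ RingHom.ker (evalGerm p) := by
      rw [Ideal.span_le]
      rintro _ ⟨i, rfl⟩
      change fderiv ℂ F p (Pi.single i 1) = 0
      simp [hp.1]
    exact hle hφ)

theorem evalAt_proj (hp : IsIsolatedCriticalPoint F p) (φ : HolGerm p) :
    evalAt hF hp (proj hF φ) = evalGerm p φ := rfl

variable {W : Type*} [AddCommGroup W] [Module ℂ W] {ι : Type*} [Fintype ι]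

/-- The subspace `Y` of `W` generated by the vectors `wₗ`. -/
abbrev spanY (w : ι → W) : Submodule ℂ W := Submodule.span ℂ (Set.range w)

/-- The map `α : A_{p,F} → Y`, `f ↦ ∑ₗ (f, hₗ)_p wₗ`. -/
def alphaMap (h : ι → LocalAlgebra hF) (w : ι → W) : LocalAlgebra hF →ₗ[ℂ] spanY w :=
  ∑ l, ((residueForm hF).flip (h l)).smulRight (⟨w l, Submodule.subset_span ⟨l, rfl⟩⟩ : spanY w)

theorem coe_alphaMap (h : ι → LocalAlgebra hF) (w : ι → W) (f : LocalAlgebra hF) :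
    (alphaMap hF h w f : W) = ∑ l, residueForm hF f (h l) • w l := by
  simp [alphaMap]

/-- The natural projection `A_{p,F} ⊗ W → A_{p,F}/𝔪_p ⊗ W = ℂ ⊗ W = W`, the value at `p`. -/
def tensorValue (hp : IsIsolatedCriticalPoint F p) : LocalAlgebra hF ⊗[ℂ] W →ₗ[ℂ] W :=
  (TensorProduct.lid ℂ W).toLinearMap ∘ₗ LinearMap.rTensor W (evalAt hF hp).toLinearMap

/-- The value `w(p)` at `p` of the element `∑ₗ hₗ ⊗ wₗ` of `A_{p,F} ⊗ W`. -/
def valueAt (hp : IsIsolatedCriticalPoint F p) (h : ι → LocalAlgebra hF) (w : ι → W) : W :=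
  tensorValue hF hp (∑ l, h l ⊗ₜ[ℂ] w l)

end LocalAlgebra

section Restriction

variable {W : Type*} [AddCommGroup W] [Module ℂ W] {n : ℕ} {M : Fin n → Module.End ℂ W}
  {Y : Submodule ℂ W}

/-- The operators `M_j|_Y` on a subspace `Y` that all `M_j` preserve. -/
def restrictOp (hY : ∀ j, ∀ y ∈ Y, M j y ∈ Y) (j : Fin n) : Module.End ℂ Y :=
  (M j).restrict (hY j)

/-- The unital subalgebra `A_Y` of `End(Y)` generated by the operators `M_j|_Y`. -/
def restrictAlgebra (hY : ∀ j, ∀ y ∈ Y, M j y ∈ Y) : Subalgebra ℂ (Module.End ℂ Y) :=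
  Algebra.adjoin ℂ (Set.range (restrictOp hY))

end Restriction

end CriticalPoint

end

noncomputable section

namespace CriticalPoint

variable {k : ℕ} {p : Fin k → ℂ}

/-! ### Germs: Hadamard's lemma and units -/

/-! Everything rests on a Bezoutian. Write x for the coordinates on 𝒪_p and y for their classes in
A, and put f_i = ∂F/∂t_i. In A ⊗ 𝒪_p each f_i(x) vanishes on the diagonal, so f_i(x) = ∑ a_ij (x_j -
y_j). Let Δ = det a. The transformation law shows that Δ has residue 1 over A. Cramer's rule puts
(φ(x) - φ(y)) Δ in the ideal of the f_i(x), so the residue of φ(x) Δ is the class of φ. On the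
diagonal Δ becomes the Hessian (`exists_bezoutian`).

Expanding Δ = ∑ a_t ⊗ b_t gives f = ∑ ρ(f b_t) a_t and ∑ a_t b_t = [Hess F]. The first formula is
local duality. For the rest, compute a trace twice. Multiplication by f has trace μ f(p), because f
- f(p) is nilpotent; the expansion gives the same trace as ρ(f [Hess F]). Hence ([Hess F], f)_p = μ
f(p) (`residueForm_hessClass`), and [Hess F] spans the socle of A.

For α, pairing the first tensor factor turns the equation for M_j into M_j α(f) = α(g_j f). Since
the M_j are self-adjoint and the g_j generate A, S(α f, α f') depends only on f f', so it equals (c,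
f f')_p for some c in A. Multiplication by c has kernel ∑ S(w_l, w_m) h_l ⊗ h_m, so its trace is
ρ((-1)^k [Hess F]) = (-1)^k μ. The trace is also μ c(p), so c(p) ≠ 0 and c is a unit
(`exists_isUnit_form_alphaMap`). The pulled back form is therefore nondegenerate, which makes α
injective; duality makes it surjective. The algebra structure is then transported along α, and the
common eigenvectors correspond to the socle. -/

theorem evalGerm_toGerm {f : (Fin k → ℂ) → ℂ} (hf : AnalyticAt ℂ f p) :
    evalGerm p (toGerm hf) = f p := rfl

theorem evalGerm_coord (i : Fin k) : evalGerm p (coord p i) = 0 := by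
  change p i - p i = 0
  simp

/-- An analytic function satisfies `f x = f x₀ + g x (x - x₀)` near `x₀`, where the function `g`
with values in the dual space is analytic at `x₀`. -/
theorem exists_analyticAt_sub_eq_apply {E : Type*} [NormedAddCommGroup E] [NormedSpace ℂ E]
    {f : E → ℂ} {x₀ : E} (hf : AnalyticAt ℂ f x₀) :
    ∃ g : E → E →L[ℂ] ℂ, AnalyticAt ℂ g x₀ ∧ ∀ᶠ x in 𝓝 x₀, f x = f x₀ + g x (x - x₀) := by
  obtain ⟨P, r, hP⟩ := hf
  have hpos : 0 < P.shift.radius := by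
    rw [P.radius_shift]
    exact hP.r_pos.trans_le hP.r_le
  have hS := P.shift.hasFPowerSeriesOnBall hpos
  -- The shifted series has P (n + 1) with one argument left free as its n-th term. Feeding x - x₀
  -- into the free slot recovers the series of f without its constant term.
  refine ⟨fun x => P.shift.sum (x - x₀), ?_, ?_⟩
  · have h0 : AnalyticAt ℂ P.shift.sum (x₀ - x₀) := by
      rw [sub_self]
      exact hS.analyticAt
    exact h0.fun_comp (f := fun x => x - x₀) (analyticAt_id.sub analyticAt_const)
  · filter_upwards [Metric.eball_mem_nhds x₀ hP.r_pos,
      Metric.eball_mem_nhds x₀ hpos] with x hx hx'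
    have h1 := hP.hasSum_sub hx
    have h2 := hS.hasSum (y := x - x₀) (by
      simpa [Metric.mem_eball, edist_eq_enorm_sub] using hx')
    have h3 := (ContinuousLinearMap.apply ℂ ℂ (x - x₀)).hasSum h2
    rw [← hasSum_nat_add_iff' 1] at h1
    simp only [Finset.sum_range_one] at h1
    have h4 := h1.unique (by
      convert h3 using 2 with n
      change _ = P (n + 1) (Fin.snoc (fun _ => x - x₀) (x - x₀))
      congr 1
      funext j
      refine Fin.lastCases ?_ (fun j => ?_) j <;> simp)
    have h5 : (P 0 fun _ => x - x₀) = f x₀ := hP.coeff_zero _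
    rw [h5] at h4
    simp only [zero_add] at h4
    rw [← sub_eq_iff_eq_add']
    exact h4

/-- Hadamard's lemma. -/
theorem exists_eq_add_sum_mul_coord (φ : HolGerm p) :
    ∃ ψ : Fin k → HolGerm p,
      φ = algebraMap ℂ (HolGerm p) (evalGerm p φ) + ∑ i, ψ i * coord p i := by
  obtain ⟨f, hf, rfl⟩ := exists_toGerm φ
  obtain ⟨g, hg, hfg⟩ := exists_analyticAt_sub_eq_apply hf
  have hgi : ∀ i, AnalyticAt ℂ (fun t => g t (Pi.single i 1)) p := fun i =>
    ((ContinuousLinearMap.apply ℂ ℂ (Pi.single i 1 : Fin k → ℂ)).analyticAt _).comp hg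
  refine ⟨fun i => toGerm (hgi i), Subtype.ext ?_⟩
  have hsum : ((∑ i, toGerm (hgi i) * coord p i : HolGerm p) : Germ (𝓝 p) ℂ) =
      ((fun t => ∑ i, g t (Pi.single i 1) * (t i - p i) : (Fin k → ℂ) → ℂ) :
        Germ (𝓝 p) ℂ) := by
    have : ∀ s : Finset (Fin k), ((∑ i ∈ s, toGerm (hgi i) * coord p i : HolGerm p) :
        Germ (𝓝 p) ℂ) = ((fun t => ∑ i ∈ s, g t (Pi.single i 1) * (t i - p i) :
          (Fin k → ℂ) → ℂ) : Germ (𝓝 p) ℂ) := by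
      intro s
      induction s using Finset.induction_on with
      | empty => simp only [Finset.sum_empty]; rfl
      | insert i s hi ih =>
        simp only [Finset.sum_insert hi]
        rw [AddMemClass.coe_add, ih]
        rfl
    exact this _
  rw [AddMemClass.coe_add, hsum]
  change _ = algebraMap ℂ (Germ (𝓝 p) ℂ) (f p) + _
  rw [algebraMap_germ]
  refine Germ.coe_eq.mpr ?_
  filter_upwards [hfg] with t ht
  refine ht.trans (congrArg (f p + ·) ?_)
  conv_lhs => rw [← Finset.univ_sum_single (t - p)]
  rw [map_sum]
  refine Finset.sum_congr rfl fun i _ => ?_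
  have : (Pi.single i ((t - p) i) : Fin k → ℂ) = (t i - p i) • Pi.single i 1 := by
    rw [← Pi.single_smul]
    simp
  rw [this, map_smul, smul_eq_mul, mul_comm]

theorem isUnit_of_evalGerm_ne_zero {φ : HolGerm p} (h : evalGerm p φ ≠ 0) : IsUnit φ := by
  obtain ⟨f, hf, rfl⟩ := exists_toGerm φ
  rw [evalGerm_toGerm] at h
  refine IsUnit.of_mul_eq_one (toGerm (hf.inv h)) (Subtype.ext (Germ.coe_eq.mpr ?_))
  filter_upwards [hf.continuousAt.eventually_ne h] with t ht
  simp [ht]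

/-! ### Taylor coefficients of monomials -/

theorem mixedDeriv_one {α : Fin k → ℕ} {i : Fin k} (hα : α i ≠ 0) {l : List (Fin k)}
    (hi : i ∈ l) : mixedDeriv α l (1 : HolGerm p) = 0 := by
  have hp : ∀ (j : Fin k) (a : ℕ),
      (pderivEnd p j ^ (a + 1)) (1 : HolGerm p) = 0 := fun j a => by
    rw [pow_succ, Module.End.mul_apply]
    change (pderivEnd p j ^ a) (pderiv j 1) = 0
    simp
  -- Knowing that only 0 and 1 occur, a factor of positive order yields 0 wherever it stands in the
  -- list.
  have h01 : ∀ l : List (Fin k), mixedDeriv α l (1 : HolGerm p) = 0 ∨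
      mixedDeriv α l (1 : HolGerm p) = 1 := by
    intro l
    induction l with
    | nil => right; simp [mixedDeriv]
    | cons j l ih =>
      rw [mixedDeriv_cons]
      rcases ih with ih | ih
      · left; rw [ih, map_zero]
      · rw [ih]
        rcases Nat.eq_zero_or_pos (α j) with h | h
        · right; simp [h]
        · left
          obtain ⟨a, ha⟩ := Nat.exists_eq_succ_of_ne_zero h.ne'
          rw [ha]; exact hp j a
  induction l with
  | nil => simp at hi
  | cons j l ih =>
    rw [mixedDeriv_cons]
    rcases List.mem_cons.mp hi with rfl | hi
    · rcases h01 l with h | h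
      · rw [h, map_zero]
      · obtain ⟨a, ha⟩ := Nat.exists_eq_succ_of_ne_zero hα
        rw [h, ha]
        exact hp i a
    · rw [ih hi, map_zero]

theorem taylorCoeff_one (α : Fin k → ℕ) :
    taylorCoeff p α 1 = if α = 0 then 1 else 0 := by
  split_ifs with h
  · subst h
    have : mixedDeriv (p := p) (0 : Fin k → ℕ) (List.finRange k) = 1 := by
      simp [mixedDeriv]
    simp [taylorCoeff, this]
  · obtain ⟨i, hi⟩ := Function.ne_iff.mp h
    simp [taylorCoeff, mixedDeriv_one hi (List.mem_finRange i)]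

theorem taylorCoeff_prod_coord_pow {α β : Fin k → ℕ} (h : β ≤ α) :
    taylorCoeff p α (∏ i, coord p i ^ β i) = if α = β then 1 else 0 := by
  have key : ∀ (γ : Fin k → ℕ) (s : Finset (Fin k)),
      taylorCoeff p (γ + ∑ i ∈ s, Pi.single i (β i)) (∏ i ∈ s, coord p i ^ β i) =
        taylorCoeff p γ 1 := by
    intro γ s
    induction s using Finset.induction_on with
    | empty => simp
    | insert i s hi ih =>
      rw [Finset.sum_insert hi, Finset.prod_insert hi,
        add_comm (Pi.single i (β i) : Fin k → ℕ), ← add_assoc, taylorCoeff_coord_pow_mul, ih]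
  -- Dividing out the monomial reduces to the coefficient of index α - β of the constant 1;
  -- truncated subtraction is harmless because β ≤ α.
  have h1 := key (α - β) Finset.univ
  rw [Finset.univ_sum_single β, tsub_add_cancel_of_le h, taylorCoeff_one] at h1
  rw [h1]
  congr 1
  rw [tsub_eq_zero_iff_le]
  exact propext ⟨fun h' => le_antisymm h' h, fun h' => h'.le⟩

/-- Iterates Hadamard's lemma: a germ is a polynomial in the coordinates modulo any power of the
maximal ideal. -/
theorem exists_mem_adjoin_sub_mem_pow (s : ℕ) (φ : HolGerm p) :
    ∃ q ∈ Algebra.adjoin ℂ (Set.range (coord p)),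
      φ - q ∈ Ideal.span (Set.range (coord p)) ^ s := by
  induction s generalizing φ with
  | zero => exact ⟨0, zero_mem _, by simp⟩
  | succ s ih =>
    obtain ⟨ψ, hψ⟩ := exists_eq_add_sum_mul_coord φ
    choose q hq hqs using fun i => ih (ψ i)
    refine ⟨algebraMap ℂ _ (evalGerm p φ) + ∑ i, q i * coord p i,
      add_mem (Subalgebra.algebraMap_mem _ _) (sum_mem fun i _ =>
        mul_mem (hq i) (Algebra.subset_adjoin ⟨i, rfl⟩)), ?_⟩
    nth_rw 1 [hψ]
    rw [add_sub_add_left_eq_sub, ← Finset.sum_sub_distrib, pow_succ]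
    refine Ideal.sum_mem _ fun i _ => ?_
    rw [← sub_mul]
    exact Ideal.mul_mem_mul (hqs i) (Ideal.subset_span ⟨i, rfl⟩)

/-- Two algebra homomorphisms from `𝒪_p` that agree on the coordinates are equal, if one of them
factors through the Taylor polynomials of some fixed order. -/
theorem algHom_ext_of_coord {B : Type*} [CommRing B] [Algebra ℂ B] {σ τ : HolGerm p →ₐ[ℂ] B}
    (h : ∀ i, σ (coord p i) = τ (coord p i)) {s : ℕ}
    (hτ : ∀ φ ∈ Ideal.span (Set.range (coord p)) ^ s, τ φ = 0) : σ = τ := by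
  have hmap : Ideal.map σ (Ideal.span (Set.range (coord p))) =
      Ideal.map τ (Ideal.span (Set.range (coord p))) := by
    rw [Ideal.map_span, Ideal.map_span, ← Set.range_comp, ← Set.range_comp]
    congr 2
    funext i
    exact h i
  have hbot : Ideal.map τ (Ideal.span (Set.range (coord p)) ^ s) = ⊥ := by
    rw [eq_bot_iff, Ideal.map_le_iff_le_comap]
    exact fun φ hφ => by simpa using hτ φ hφ
  -- The image of the maximal ideal generates the same ideal under σ and τ, so σ inherits the
  -- vanishing on the s-th power.
  have hσ : ∀ φ ∈ Ideal.span (Set.range (coord p)) ^ s, σ φ = 0 := by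
    intro φ hφ
    have := Ideal.mem_map_of_mem σ hφ
    rwa [Ideal.map_pow, hmap, ← Ideal.map_pow, hbot, Ideal.mem_bot] at this
  have hle : Algebra.adjoin ℂ (Set.range (coord p)) ≤ AlgHom.equalizer σ τ := by
    rw [Algebra.adjoin_le_iff]
    rintro _ ⟨i, rfl⟩
    exact h i
  ext φ
  obtain ⟨q, hq, hqs⟩ := exists_mem_adjoin_sub_mem_pow s φ
  have h1 : σ q = τ q := hle hq
  have h2 := hσ _ hqs
  have h3 := hτ _ hqs
  rw [map_sub, sub_eq_zero] at h2 h3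
  rw [h2, h3, h1]

/-! ### Extension of scalars -/

variable {A : Type*} [CommRing A] [Algebra ℂ A]

/-- The `A`-linear extension to `A ⊗ 𝒪_p` of a linear function on `𝒪_p`. -/
def scalarExt (A : Type*) [CommRing A] [Algebra ℂ A] (ℓ : HolGerm p →ₗ[ℂ] ℂ) :
    A ⊗[ℂ] HolGerm p →ₗ[A] A :=
  (AlgebraTensorModule.rid ℂ A A).toLinearMap ∘ₗ ℓ.baseChange A

theorem scalarExt_tmul (ℓ : HolGerm p →ₗ[ℂ] ℂ) (a : A) (φ : HolGerm p) :
    scalarExt A ℓ (a ⊗ₜ φ) = ℓ φ • a := by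
  simp [scalarExt]

theorem scalarExt_tmul_one_mul (ℓ : HolGerm p →ₗ[ℂ] ℂ) (a : A) (u : A ⊗[ℂ] HolGerm p) :
    scalarExt A ℓ ((a ⊗ₜ 1) * u) = a * scalarExt A ℓ u := by
  have : (a ⊗ₜ 1) * u = a • u := by
    induction u using TensorProduct.induction_on with
    | zero => simp
    | tmul b φ =>
      rw [Algebra.TensorProduct.tmul_mul_tmul, one_mul, TensorProduct.smul_tmul', smul_eq_mul]
    | add u v hu hv => rw [mul_add, smul_add, hu, hv]
  rw [this, map_smul, smul_eq_mul]

/-- Carries identities between functionals over to A ⊗ 𝒪_p: coefficient shifts, vanishing (ℓ' = 0)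
and the formula for the residue all pass through it. -/
theorem scalarExt_one_tmul_mul {ℓ ℓ' : HolGerm p →ₗ[ℂ] ℂ} {ψ : HolGerm p}
    (h : ∀ φ, ℓ (ψ * φ) = ℓ' φ) (u : A ⊗[ℂ] HolGerm p) :
    scalarExt A ℓ ((1 ⊗ₜ ψ) * u) = scalarExt A ℓ' u := by
  induction u using TensorProduct.induction_on with
  | zero => simp
  | tmul a φ =>
    rw [Algebra.TensorProduct.tmul_mul_tmul, scalarExt_tmul, scalarExt_tmul, h, one_mul]
  | add u v hu hv => rw [mul_add, map_add, map_add, hu, hv]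

/-! ### The transformation law with coefficients in A -/

/-- The extension to `A ⊗ 𝒪_p` of the coefficient functions of the Taylor expansion. -/
abbrev taylorExt (A : Type*) [CommRing A] [Algebra ℂ A] (p : Fin k → ℂ) (α : Fin k → ℕ) :
    A ⊗[ℂ] HolGerm p →ₗ[A] A := scalarExt A (taylorCoeff p α)

/-- The coordinate `t_i - p_i` as an element of `A ⊗ 𝒪_p`. -/
abbrev coordExt (A : Type*) [CommRing A] [Algebra ℂ A] (p : Fin k → ℂ) (i : Fin k) :
    A ⊗[ℂ] HolGerm p := 1 ⊗ₜ coord p i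

theorem taylorExt_coord_pow_mul_eq_zero (α : Fin k → ℕ) (i : Fin k) (u : A ⊗[ℂ] HolGerm p) :
    taylorExt A p α (coordExt A p i ^ (α i + 1) * u) = 0 := by
  have := scalarExt_one_tmul_mul (A := A) (ℓ := taylorCoeff p α) (ℓ' := 0)
    (ψ := coord p i ^ (α i + 1)) (fun φ => taylorCoeff_eq_zero α i _
      (Ideal.mul_mem_right _ _ (Ideal.mem_span_singleton_self _))) u
  rw [Algebra.TensorProduct.tmul_pow, one_pow, this]
  simp [scalarExt]

theorem taylorExt_coord_pow_mul (i : Fin k) (α : Fin k → ℕ) (m : ℕ) (u : A ⊗[ℂ] HolGerm p) :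
    taylorExt A p (α + Pi.single i m) (coordExt A p i ^ m * u) = taylorExt A p α u := by
  rw [Algebra.TensorProduct.tmul_pow, one_pow]
  exact scalarExt_one_tmul_mul (taylorCoeff_coord_pow_mul i α m) u

/-- Multiply by x_i^{N+1}, raise the i-th exponent accordingly, and expand that power in the z_l. By
Cramer's rule D.det * z_l is a combination of the entries of D z. The i-th entry is zero, and the
others are x_j^{N+1}, too high for the exponent N of x_j. -/
theorem taylorExt_det_eq_zero {z : Fin k → A ⊗[ℂ] HolGerm p} {N : ℕ} (i : Fin k)
    {D : Matrix (Fin k) (Fin k) (A ⊗[ℂ] HolGerm p)} (hi : ∑ j, D i j * z j = 0)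
    (hD : ∀ l, l ≠ i → coordExt A p l ^ (N + 1) = ∑ j, D l j * z j)
    (hz : ∃ c : Fin k → A ⊗[ℂ] HolGerm p, coordExt A p i ^ (N + 1) = ∑ j, c j * z j) :
    taylorExt A p (fun _ => N) D.det = 0 := by
  obtain ⟨c, hc⟩ := hz
  rw [← taylorExt_coord_pow_mul i (fun _ => N) (N + 1), hc, Finset.sum_mul, map_sum]
  refine Finset.sum_eq_zero fun l _ => ?_
  have hvec : D.det • z = D.adjugate.mulVec (D.mulVec z) := by
    rw [Matrix.mulVec_mulVec, Matrix.adjugate_mul, Matrix.smul_mulVec, Matrix.one_mulVec]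
  have hl : D.det * z l = ∑ j, D.adjugate l j * D.mulVec z j := congrFun hvec l
  rw [mul_assoc, mul_comm (z l), hl, Finset.mul_sum, map_sum]
  refine Finset.sum_eq_zero fun j _ => ?_
  by_cases hj : j = i
  · have : D.mulVec z j = 0 := by rw [hj]; exact hi
    simp [this]
  · have h1 : D.mulVec z j = coordExt A p j ^ (N + 1) := (hD j hj).symm
    have h2 := taylorExt_coord_pow_mul_eq_zero (A := A) (p := p)
      ((fun _ => N) + Pi.single i (N + 1)) j (c l * D.adjugate l j)
    rw [h1, ← mul_assoc, mul_comm]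
    simpa [hj] using h2

/-- The transformation law: two expressions `x_i^{N+1} = ∑ⱼ C i j * z j` over `A ⊗ 𝒪_p` give the
same coefficient of `∏ᵢ x_i^N` in the determinant of `C`. -/
theorem taylorExt_det_eq {z : Fin k → A ⊗[ℂ] HolGerm p} {N : ℕ}
    {C C' : Matrix (Fin k) (Fin k) (A ⊗[ℂ] HolGerm p)}
    (hC : ∀ i, coordExt A p i ^ (N + 1) = ∑ j, C i j * z j)
    (hC' : ∀ i, coordExt A p i ^ (N + 1) = ∑ j, C' i j * z j) :
    taylorExt A p (fun _ => N) C.det = taylorExt A p (fun _ => N) C'.det := by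
  classical
  -- Rows of C are replaced by rows of C' one at a time. By multilinearity each replacement changes
  -- the determinant by one whose i-th row, C' i - C i, annihilates z.
  have key : ∀ s : Finset (Fin k),
      taylorExt A p (fun _ => N) (Matrix.of fun i => if i ∈ s then C' i else C i).det =
        taylorExt A p (fun _ => N) C.det := by
    intro s
    induction s using Finset.induction_on with
    | empty => congr 2
    | insert i s hi ih =>
      rw [← ih, ← sub_eq_zero, ← map_sub]
      set B : Matrix (Fin k) (Fin k) (A ⊗[ℂ] HolGerm p) :=
        Matrix.of fun i => if i ∈ s then C' i else C i with hB
      have h1 : (Matrix.of fun j => if j ∈ insert i s then C' j else C j) =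
          B.updateRow i (C' i) := by
        ext a b
        by_cases ha : a = i
        · subst ha
          simp
        · simp [hB, ha]
      have h2 : B = B.updateRow i (C i) := by
        ext a b
        by_cases ha : a = i
        · subst ha
          simp [hB, hi]
        · simp [ha]
      have h3 : (B.updateRow i (C' i)).det - B.det = (B.updateRow i (C' i - C i)).det := by
        have := Matrix.det_updateRow_add B i (C' i - C i) (C i)
        rw [sub_add_cancel, ← h2] at this
        rw [this, add_sub_cancel_right]
      rw [h1, h3]
      refine taylorExt_det_eq_zero (z := z) i ?_ ?_ ⟨C i, hC i⟩
      · simp only [Matrix.updateRow_self, Pi.sub_apply, sub_mul, Finset.sum_sub_distrib]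
        rw [← hC i, ← hC' i, sub_self]
      · intro l hl
        by_cases hs : l ∈ s
        · simpa only [hB, Matrix.updateRow_ne hl, Matrix.of_apply, if_pos hs] using hC' l
        · simpa only [hB, Matrix.updateRow_ne hl, Matrix.of_apply, if_neg hs] using hC l
  rw [← key Finset.univ]
  congr 2
  ext a b
  simp

/-- The coefficient of `∏ᵢ x_i^N` in `∏ᵢ ∑ₐ x_i^a y_i^{N-a}` is `1`. -/
theorem taylorExt_prod_geom_sum (y : Fin k → A) (N : ℕ) :
    taylorExt A p (fun _ => N) (∏ i, ∑ a ∈ Finset.range (N + 1),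
      coordExt A p i ^ a * (y i ⊗ₜ[ℂ] (1 : HolGerm p)) ^ (N - a)) = 1 := by
  classical
  rw [Finset.prod_univ_sum, map_sum]
  have hterm : ∀ β : Fin k → ℕ, (∏ i, coordExt A p i ^ β i *
      (y i ⊗ₜ[ℂ] (1 : HolGerm p)) ^ (N - β i)) =
        (∏ i, y i ^ (N - β i)) ⊗ₜ[ℂ] ∏ i, coord p i ^ β i := by
    intro β
    have h1 : ∏ i, coordExt A p i ^ β i = 1 ⊗ₜ ∏ i, coord p i ^ β i := by
      have := map_prod (Algebra.TensorProduct.includeRight : HolGerm p →ₐ[ℂ] A ⊗[ℂ] HolGerm p)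
        (fun i => coord p i ^ β i) Finset.univ
      simp only [map_pow] at this
      exact this.symm
    have h2 : ∏ i, (y i ⊗ₜ[ℂ] (1 : HolGerm p)) ^ (N - β i) = (∏ i, y i ^ (N - β i)) ⊗ₜ 1 := by
      have := map_prod (Algebra.TensorProduct.includeLeft : A →ₐ[ℂ] A ⊗[ℂ] HolGerm p)
        (fun i => y i ^ (N - β i)) Finset.univ
      simp only [map_pow] at this
      exact this.symm
    rw [Finset.prod_mul_distrib, h1, h2, Algebra.TensorProduct.tmul_mul_tmul, one_mul, mul_one]
  -- Every monomial in the expansion has exponents at most N, so only the top one has a nonzero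
  -- coefficient at (N, …, N), and there the y-part is 1.
  rw [Finset.sum_eq_single (fun _ => N)]
  · rw [hterm, scalarExt_tmul, taylorCoeff_prod_coord_pow le_rfl]
    simp
  · intro β hβ hne
    rw [hterm, scalarExt_tmul, taylorCoeff_prod_coord_pow, if_neg (Ne.symm hne), zero_smul]
    intro i
    have := Fintype.mem_piFinset.mp hβ i
    simpa [Nat.lt_succ_iff] using this
  · intro hn
    exact absurd (Fintype.mem_piFinset.mpr fun i => by simp) hn

/-- The extension of `∂/∂tᵢ` to `A ⊗ 𝒪_p`. -/
def pderivExt (A : Type*) [CommRing A] [Algebra ℂ A] (p : Fin k → ℂ) (i : Fin k) :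
    A ⊗[ℂ] HolGerm p →ₗ[ℂ] A ⊗[ℂ] HolGerm p := LinearMap.lTensor A (pderivEnd p i)

theorem pderivExt_tmul (i : Fin k) (a : A) (φ : HolGerm p) :
    pderivExt A p i (a ⊗ₜ φ) = a ⊗ₜ pderiv i φ := rfl

/-- The Leibniz rule for a factor x_j - b; elements of A are constants for the derivation. On the
diagonal x_j = y_j only the last term will survive. -/
theorem pderivExt_mul_coord_sub (i j : Fin k) (b : A) (u : A ⊗[ℂ] HolGerm p) :
    pderivExt A p i (u * (coordExt A p j - b ⊗ₜ 1)) =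
      pderivExt A p i u * (coordExt A p j - b ⊗ₜ 1) + if i = j then u else 0 := by
  induction u using TensorProduct.induction_on with
  | zero => simp
  | tmul a φ =>
    have h := pderiv_coord_mul j i φ
    rw [mul_sub, Algebra.TensorProduct.tmul_mul_tmul, Algebra.TensorProduct.tmul_mul_tmul,
      map_sub, pderivExt_tmul, pderivExt_tmul, pderivExt_tmul, mul_comm φ, h, mul_sub,
      Algebra.TensorProduct.tmul_mul_tmul, Algebra.TensorProduct.tmul_mul_tmul,
      TensorProduct.tmul_add, mul_comm (coord p j)]
    simp only [mul_one]
    split_ifs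
    · abel
    · rw [TensorProduct.tmul_zero]
      abel
  | add u v hu hv =>
    rw [add_mul, map_add, hu, hv, map_add, add_mul]
    split_ifs <;> abel

/-! ### The ideal of the diagonal and the Bezoutian -/

/-- The homomorphism `A ⊗ 𝒪_p → A`, `a ⊗ φ ↦ a π(φ)`. -/
abbrev diagHom (π : HolGerm p →ₐ[ℂ] A) : A ⊗[ℂ] HolGerm p →ₐ[ℂ] A :=
  Algebra.TensorProduct.productMap (AlgHom.id ℂ A) π

/-- The difference of the two copies of the coordinate `t_i - p_i` in `A ⊗ 𝒪_p`. -/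
abbrev coordDiff (π : HolGerm p →ₐ[ℂ] A) (i : Fin k) : A ⊗[ℂ] HolGerm p :=
  coordExt A p i - π (coord p i) ⊗ₜ 1

/-- Modulo the ideal of the coordinate differences, φ ↦ 1 ⊗ φ and φ ↦ π φ ⊗ 1 agree on coordinates,
and the second kills a power of the maximal ideal, so they coincide. -/
theorem one_tmul_sub_mem_span_coordDiff (π : HolGerm p →ₐ[ℂ] A) {s : ℕ}
    (hπ : ∀ φ ∈ Ideal.span (Set.range (coord p)) ^ s, π φ = 0) (φ : HolGerm p) :
    1 ⊗ₜ φ - π φ ⊗ₜ 1 ∈ Ideal.span (Set.range (coordDiff π)) := by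
  set K := Ideal.span (Set.range (coordDiff π))
  let σ : HolGerm p →ₐ[ℂ] A ⊗[ℂ] HolGerm p := Algebra.TensorProduct.includeRight
  let τ : HolGerm p →ₐ[ℂ] A ⊗[ℂ] HolGerm p := Algebra.TensorProduct.includeLeft.comp π
  let q : A ⊗[ℂ] HolGerm p →ₐ[ℂ] (A ⊗[ℂ] HolGerm p) ⧸ K := Ideal.Quotient.mkₐ ℂ K
  have h : q.comp σ = q.comp τ := by
    refine algHom_ext_of_coord (B := (A ⊗[ℂ] HolGerm p) ⧸ K) (σ := q.comp σ) (τ := q.comp τ)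
      (s := s) (fun i => ?_) fun φ hφ => ?_
    · have : coordDiff π i ∈ K := Ideal.subset_span ⟨i, rfl⟩
      exact Ideal.Quotient.eq.mpr this
    · have : τ φ = 0 := by
        change π φ ⊗ₜ[ℂ] (1 : HolGerm p) = 0
        rw [hπ φ hφ, TensorProduct.zero_tmul]
      rw [AlgHom.comp_apply, this, map_zero]
  exact Ideal.Quotient.eq.mp (DFunLike.congr_fun h φ)

theorem scalarExt_residueGerm_eq_zero (f : Fin k → HolGerm p) {u : A ⊗[ℂ] HolGerm p}
    (hu : u ∈ Ideal.span (Set.range fun i => (1 : A) ⊗ₜ[ℂ] f i)) :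
    scalarExt A (residueGerm f) u = 0 := by
  obtain ⟨c, rfl⟩ := Ideal.mem_span_range_iff_exists_fun.mp hu
  rw [map_sum]
  refine Finset.sum_eq_zero fun i _ => ?_
  rw [mul_comm, scalarExt_one_tmul_mul (ℓ' := 0) fun φ => residueGerm_eq_zero f _
    (Ideal.mul_mem_right _ _ (Ideal.subset_span ⟨i, rfl⟩))]
  simp [scalarExt]

/-- Cramer's rule: a.det * z_l is a combination of the v_j through the adjugate. -/
theorem det_mul_mem_span {R ι : Type*} [CommRing R] [Fintype ι] [DecidableEq ι]
    {a : Matrix ι ι R} {z v : ι → R} (h : ∀ i, v i = ∑ j, a i j * z j) {u : R}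
    (hu : u ∈ Ideal.span (Set.range z)) : u * a.det ∈ Ideal.span (Set.range v) := by
  obtain ⟨c, rfl⟩ := Ideal.mem_span_range_iff_exists_fun.mp hu
  rw [Finset.sum_mul]
  refine Ideal.sum_mem _ fun l _ => ?_
  have hvec : a.det • z = a.adjugate.mulVec v := by
    rw [show v = a.mulVec z from funext h, Matrix.mulVec_mulVec, Matrix.adjugate_mul,
      Matrix.smul_mulVec, Matrix.one_mulVec]
  have hl : a.det * z l = ∑ j, a.adjugate l j * v j := congrFun hvec l
  rw [mul_assoc, mul_comm (z l), hl]
  exact Ideal.mul_mem_left _ _ (Ideal.sum_mem _ fun j _ =>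
    Ideal.mul_mem_left _ _ (Ideal.subset_span ⟨j, rfl⟩))

/-- The Bezoutian: an element of `A ⊗ 𝒪_p` that reproduces `A` under the residue, and whose
restriction to the diagonal is the Jacobian of `f`. -/
theorem exists_bezoutian {f : Fin k → HolGerm p} {s : ℕ}
    (hf : Ideal.span (Set.range (coord p)) ^ s ≤ Ideal.span (Set.range f))
    (π : HolGerm p →ₐ[ℂ] A) (hπ : ∀ φ ∈ Ideal.span (Set.range f), π φ = 0) :
    ∃ Δ : A ⊗[ℂ] HolGerm p,
      (∀ φ, scalarExt A (residueGerm f) ((1 ⊗ₜ φ) * Δ) = π φ) ∧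
      diagHom π Δ = π (Matrix.det (Matrix.of fun l m : Fin k => pderiv l (f m))) := by
  have hπs : ∀ φ ∈ Ideal.span (Set.range (coord p)) ^ s, π φ = 0 := fun φ hφ => hπ φ (hf hφ)
  -- The exponent is s + 1 rather than s because a residue datum of order N concerns the powers N +
  -- 1.
  have hcoord : ∀ i, coord p i ^ (s + 1) ∈ Ideal.span (Set.range f) := fun i =>
    hf (Ideal.pow_le_pow_right (Nat.le_succ s)
      (Ideal.pow_mem_pow (Ideal.subset_span (Set.mem_range_self i)) _))
  have hfi : ∀ i, ∃ a : Fin k → A ⊗[ℂ] HolGerm p,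
      (1 : A) ⊗ₜ[ℂ] f i = ∑ j, a j * coordDiff π j := fun i => by
    have h := one_tmul_sub_mem_span_coordDiff π hπs (f i)
    rw [hπ (f i) (Ideal.subset_span ⟨i, rfl⟩), TensorProduct.zero_tmul, sub_zero] at h
    obtain ⟨a, ha⟩ := Ideal.mem_span_range_iff_exists_fun.mp h
    exact ⟨a, ha.symm⟩
  choose a ha using hfi
  choose C hC using fun i => Ideal.mem_span_range_iff_exists_fun.mp (hcoord i)
  have hdatum : IsResidueDatum f s (Matrix.of C) := fun i => (hC i).symm
  set ι : HolGerm p →ₐ[ℂ] A ⊗[ℂ] HolGerm p := Algebra.TensorProduct.includeRight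
  have hone : scalarExt A (residueGerm f) (Matrix.of a).det = 1 := by
    have h1 : scalarExt A (residueGerm f) (Matrix.of a).det =
        taylorExt A p (fun _ => s) (((Matrix.of C).map ι) * Matrix.of a).det := by
      have hdet : ((Matrix.of C).map ι).det = 1 ⊗ₜ (Matrix.of C).det :=
        (AlgHom.map_det ι (Matrix.of C)).symm
      rw [Matrix.det_mul, hdet]
      exact (scalarExt_one_tmul_mul (fun φ => (residueGerm_eq hdatum φ).symm) _).symm
    -- Two expressions of x_i^{s+1} through the x_j - y_j are compared: the matrix C a, and the
    -- diagonal matrix of geometric sums. The latter is available because y_i^{s+1} = 0 in A.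
    rw [h1, ← taylorExt_prod_geom_sum (A := A) (p := p) (fun i => π (coord p i)) s,
      ← Matrix.det_diagonal]
    refine taylorExt_det_eq (z := coordDiff π) (fun i => ?_) (fun i => ?_)
    · have h2 : coordExt A p i ^ (s + 1) = ∑ l, ι (C i l) * ι (f l) := by
        rw [Algebra.TensorProduct.tmul_pow, one_pow, ← hC i]
        change ι _ = _
        simp only [map_sum, map_mul]
      rw [h2]
      have h3 : ∀ l, ι (f l) = ∑ j, a l j * coordDiff π j := ha
      simp only [h3, Matrix.mul_apply, Matrix.map_apply, Matrix.of_apply, Finset.sum_mul,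
        Finset.mul_sum, mul_assoc]
      exact Finset.sum_comm
    · have hy : (π (coord p i) ⊗ₜ[ℂ] (1 : HolGerm p)) ^ (s + 1) = 0 := by
        rw [Algebra.TensorProduct.tmul_pow, ← map_pow, hπ _ (hcoord i), TensorProduct.zero_tmul]
      have h2 := geom_sum₂_mul (coordExt A p i) (π (coord p i) ⊗ₜ[ℂ] (1 : HolGerm p)) (s + 1)
      rw [hy, sub_zero] at h2
      rw [← h2, Finset.sum_eq_single i (fun j _ hj => by
        rw [Matrix.diagonal_apply_ne' _ hj, zero_mul]) (by simp), Matrix.diagonal_apply_eq]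
      simp only [Nat.add_sub_cancel]
  refine ⟨(Matrix.of a).det, fun φ => ?_, ?_⟩
  · have h0 := scalarExt_residueGerm_eq_zero f (det_mul_mem_span (a := Matrix.of a) ha
      (one_tmul_sub_mem_span_coordDiff π hπs φ))
    rw [sub_mul, map_sub, sub_eq_zero] at h0
    rw [h0, scalarExt_tmul_one_mul, hone, mul_one]
  · have hz : ∀ j, diagHom π (coordDiff π j) = 0 := fun j => by simp
    rw [AlgHom.map_det, AlgHom.map_det, ← Matrix.det_transpose]
    congr 1
    ext l i
    simp only [AlgHom.mapMatrix_apply, Matrix.transpose_apply, Matrix.map_apply, Matrix.of_apply]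
    -- Differentiating f_i = ∑ a_ij (x_j - y_j) in x_l and restricting to the diagonal leaves the
    -- entry a_il.
    have h1 := congrArg (fun u => diagHom π (pderivExt A p l u)) (ha i)
    simp only [map_sum, pderivExt_mul_coord_sub, map_add, map_mul, hz, mul_zero, zero_add,
      pderivExt_tmul, apply_ite (diagHom π), map_zero, Finset.sum_ite_eq, Finset.mem_univ,
      if_true] at h1
    rw [← h1]
    simp

theorem exists_reproducing_finset {f : Fin k → HolGerm p} {s : ℕ}
    (hf : Ideal.span (Set.range (coord p)) ^ s ≤ Ideal.span (Set.range f))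
    (π : HolGerm p →ₐ[ℂ] A) (hπ : ∀ φ ∈ Ideal.span (Set.range f), π φ = 0) :
    ∃ T : Finset (A × HolGerm p),
      (∀ φ, ∑ t ∈ T, residueGerm f (φ * t.2) • t.1 = π φ) ∧
      ∑ t ∈ T, t.1 * π t.2 = π (Matrix.det (Matrix.of fun l m : Fin k => pderiv l (f m))) := by
  obtain ⟨Δ, h1, h2⟩ := exists_bezoutian hf π hπ
  obtain ⟨T, rfl⟩ := TensorProduct.exists_finset Δ
  refine ⟨T, fun φ => ?_, ?_⟩
  · rw [← h1 φ, Finset.mul_sum, map_sum]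
    simp [Algebra.TensorProduct.tmul_mul_tmul, scalarExt_tmul]
  · rw [← h2]
    simp

/-! ### Duality in the local algebra -/

section LocalAlgebra

variable {F : (Fin k → ℂ) → ℂ} (hF : AnalyticAt ℂ F p)

theorem isUnit_of_evalAt_ne_zero (hp : IsIsolatedCriticalPoint F p) {f : LocalAlgebra hF}
    (hf : evalAt hF hp f ≠ 0) : IsUnit f := by
  obtain ⟨φ, rfl⟩ := proj_surjective hF f
  exact (isUnit_of_evalGerm_ne_zero hf).map (proj hF)

/-- The element 1 plus a multiple of f has value 1 at p, hence is a unit. -/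
theorem mem_jacobson_of_evalAt_eq_zero (hp : IsIsolatedCriticalPoint F p) {f : LocalAlgebra hF}
    (hf : evalAt hF hp f = 0) : f ∈ (⊥ : Ideal (LocalAlgebra hF)).jacobson := by
  rw [Ideal.mem_jacobson_bot]
  refine fun y => isUnit_of_evalAt_ne_zero hF hp ?_
  simp [hf]

/-! ### Operators and the form S along α -/

variable {W : Type*} [AddCommGroup W] [Module ℂ W] {ι : Type*} [Fintype ι]

/-- Contract the first tensor factor of the hypothesis with (f, ·)_p. -/
theorem apply_alphaMap {h : ι → LocalAlgebra hF} {w : ι → W} {M : Module.End ℂ W}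
    {g : LocalAlgebra hF} (hM : ∑ l, h l ⊗ₜ[ℂ] M (w l) = ∑ l, (g * h l) ⊗ₜ[ℂ] w l)
    (f : LocalAlgebra hF) : M (alphaMap hF h w f) = alphaMap hF h w (g * f) := by
  have := congrArg (fun u => TensorProduct.lid ℂ W
    (LinearMap.rTensor W (residueForm hF f) u)) hM
  simp only [map_sum, LinearMap.rTensor_tmul, TensorProduct.lid_tmul] at this
  rw [coe_alphaMap, coe_alphaMap, map_sum]
  simp only [map_smul]
  rw [this]
  refine Finset.sum_congr rfl fun l _ => ?_
  rw [residueForm_apply, residueForm_apply]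
  congr 2
  ring

/-- Self-adjointness lets each generator move across S; the elements that can move form a
subalgebra, hence all of A. -/
theorem form_alphaMap {n : ℕ} {g : Fin n → LocalAlgebra hF}
    (hg : Algebra.adjoin ℂ (Set.range g) = ⊤) {S : LinearMap.BilinForm ℂ W}
    {M : Fin n → Module.End ℂ W} (hM : ∀ j u v, S (M j u) v = S u (M j v))
    {h : ι → LocalAlgebra hF} {w : ι → W}
    (hα : ∀ j f, M j (alphaMap hF h w f) = alphaMap hF h w (g j * f)) (f f' : LocalAlgebra hF) :
    S (alphaMap hF h w f) (alphaMap hF h w f') =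
      S (alphaMap hF h w 1) (alphaMap hF h w (f * f')) := by
  have hall : ∀ φ f f' : LocalAlgebra hF, S (alphaMap hF h w (φ * f)) (alphaMap hF h w f') =
      S (alphaMap hF h w f) (alphaMap hF h w (φ * f')) := by
    intro φ
    have hφ : φ ∈ Algebra.adjoin ℂ (Set.range g) := hg ▸ Algebra.mem_top
    induction hφ using Algebra.adjoin_induction with
    | mem x hx =>
      obtain ⟨j, rfl⟩ := hx
      intro f f'
      rw [← hα, ← hα, hM]
    | algebraMap r =>
      intro f f'
      simp [← Algebra.smul_def]
    | add x y _ _ hx hy =>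
      intro f f'
      simp [add_mul, hx f f', hy f f']
    | mul x y _ _ hx hy =>
      intro f f'
      rw [mul_assoc, hx, hy, ← mul_assoc, mul_comm y x]
  have := hall f 1 f'
  rwa [mul_one] at this

theorem valueAt_eq_sum (hp : IsIsolatedCriticalPoint F p) (h : ι → LocalAlgebra hF) (w : ι → W) :
    valueAt hF hp h w = ∑ l, evalAt hF hp (h l) • w l := by
  simp [valueAt, tensorValue]

/-! ### Nilpotence, traces, duality and the socle -/

variable [Module.Finite ℂ (LocalAlgebra hF)]

theorem exists_jacobson_pow_eq_bot :
    ∃ s, (⊥ : Ideal (LocalAlgebra hF)).jacobson ^ s = ⊥ := by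
  have : IsArtinianRing (LocalAlgebra hF) := IsArtinianRing.of_finite ℂ _
  exact IsArtinianRing.isNilpotent_jacobson_bot

theorem isNilpotent_of_evalAt_eq_zero (hp : IsIsolatedCriticalPoint F p) {f : LocalAlgebra hF}
    (hf : evalAt hF hp f = 0) : IsNilpotent f := by
  obtain ⟨s, hs⟩ := exists_jacobson_pow_eq_bot hF
  have := Ideal.pow_mem_pow (mem_jacobson_of_evalAt_eq_zero hF hp hf) s
  rw [hs] at this
  exact ⟨s, this⟩

/-- The coordinates vanish at p, so their classes lie in the nilpotent Jacobson radical of A. -/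
theorem exists_pow_le_span_gradGerm (hp : IsIsolatedCriticalPoint F p) :
    ∃ s, Ideal.span (Set.range (coord p)) ^ s ≤ Ideal.span (Set.range (gradGerm hF)) := by
  obtain ⟨s, hs⟩ := exists_jacobson_pow_eq_bot hF
  refine ⟨s, fun φ hφ => ?_⟩
  rw [← proj_eq_zero_iff]
  have hle : Ideal.span (Set.range (coord p)) ≤
      Ideal.comap (proj hF) (⊥ : Ideal (LocalAlgebra hF)).jacobson := by
    rw [Ideal.span_le]
    rintro _ ⟨i, rfl⟩
    exact mem_jacobson_of_evalAt_eq_zero hF hp (evalGerm_coord i)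
  have := Ideal.le_comap_pow (proj hF) s (Ideal.pow_right_mono hle s hφ)
  rw [hs] at this
  exact this

/-- Multiplication by f - f(p) is nilpotent and so has trace zero. -/
theorem trace_eq_milnorNumber_mul (hp : IsIsolatedCriticalPoint F p) (f : LocalAlgebra hF) :
    Algebra.trace ℂ (LocalAlgebra hF) f = milnorNumber hF * evalAt hF hp f := by
  have h0 : evalAt hF hp (f - algebraMap ℂ _ (evalAt hF hp f)) = 0 := by
    rw [map_sub, AlgHom.commutes, Algebra.algebraMap_self_apply, sub_self]
  have h1 := (Algebra.isNilpotent_trace_of_isNilpotent (R := ℂ)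
    (isNilpotent_of_evalAt_eq_zero hF hp h0)).eq_zero
  rw [map_sub, sub_eq_zero, Algebra.trace_algebraMap] at h1
  rw [h1, nsmul_eq_mul]
  rfl

/-- The trace of a multiplication operator that is expressed through the residue. -/
theorem milnorNumber_mul_evalAt_eq (hp : IsIsolatedCriticalPoint F p) {c : LocalAlgebra hF}
    {ι : Type*} {T : Finset ι} {a b : ι → LocalAlgebra hF}
    (h : ∀ f, c * f = ∑ t ∈ T, localResidue hF (a t * f) • b t) :
    milnorNumber hF * evalAt hF hp c = localResidue hF (∑ t ∈ T, a t * b t) := by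
  have hc : Algebra.lmul ℂ (LocalAlgebra hF) c = ∑ t ∈ T,
      (localResidue hF ∘ₗ LinearMap.mulLeft ℂ (a t)).smulRight (b t) := by
    ext f
    simpa using h f
  rw [← trace_eq_milnorNumber_mul, Algebra.trace_apply, hc, map_sum, map_sum]
  simp [LinearMap.trace_smulRight]

theorem exists_reproducing_finset_localAlgebra (hp : IsIsolatedCriticalPoint F p) :
    ∃ T : Finset (LocalAlgebra hF × HolGerm p),
      (∀ f, f = ∑ t ∈ T, localResidue hF (f * proj hF t.2) • t.1) ∧
      ∑ t ∈ T, t.1 * proj hF t.2 = hessClass hF := by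
  obtain ⟨s, hs⟩ := exists_pow_le_span_gradGerm hF hp
  obtain ⟨T, h1, h2⟩ := exists_reproducing_finset hs (proj hF)
    (fun φ hφ => (proj_eq_zero_iff hF φ).mpr hφ)
  refine ⟨T, fun f => ?_, h2⟩
  obtain ⟨φ, rfl⟩ := proj_surjective hF f
  refine (h1 φ).symm.trans (Finset.sum_congr rfl fun t _ => ?_)
  rw [← map_mul, localResidue_proj]

/-- Local duality: the residue form is nondegenerate. -/
theorem residueForm_injective (hp : IsIsolatedCriticalPoint F p) :
    Function.Injective (residueForm hF) := by
  rw [← LinearMap.ker_eq_bot, LinearMap.ker_eq_bot']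
  intro f hf
  obtain ⟨T, h, -⟩ := exists_reproducing_finset_localAlgebra hF hp
  rw [h f]
  refine Finset.sum_eq_zero fun t _ => ?_
  rw [← residueForm_apply, hf, LinearMap.zero_apply, zero_smul]

theorem residueForm_surjective (hp : IsIsolatedCriticalPoint F p) :
    Function.Surjective (residueForm hF) :=
  (LinearMap.injective_iff_surjective_of_finrank_eq_finrank
    (Subspace.dual_finrank_eq (K := ℂ) (V := LocalAlgebra hF)).symm).mp
      (residueForm_injective hF hp)

/-- The residue pairing with the class of the Hessian is `μ` times the value at `p`. -/
theorem residueForm_hessClass (hp : IsIsolatedCriticalPoint F p) (f : LocalAlgebra hF) :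
    residueForm hF (hessClass hF) f = milnorNumber hF * evalAt hF hp f := by
  obtain ⟨T, h, hH⟩ := exists_reproducing_finset_localAlgebra hF hp
  rw [milnorNumber_mul_evalAt_eq hF hp (T := T) (a := fun t => f * proj hF t.2)
    (b := fun t => t.1) (fun g => by
      conv_lhs => rw [h (f * g)]
      exact Finset.sum_congr rfl fun t _ => by rw [mul_right_comm]),
    residueForm_apply, ← hH, Finset.sum_mul]
  congr 1
  exact Finset.sum_congr rfl fun t _ => by ring

theorem milnorNumber_ne_zero (hp : IsIsolatedCriticalPoint F p) : (milnorNumber hF : ℂ) ≠ 0 := by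
  have : Nontrivial (LocalAlgebra hF) := (evalAt hF hp).toRingHom.domain_nontrivial
  exact_mod_cast (Module.finrank_pos (R := ℂ) (M := LocalAlgebra hF)).ne'

theorem hessClass_ne_zero (hp : IsIsolatedCriticalPoint F p) : hessClass hF ≠ 0 := by
  intro h
  have := residueForm_hessClass hF hp 1
  rw [h, map_zero, LinearMap.zero_apply, map_one, mul_one] at this
  exact milnorNumber_ne_zero hF hp this.symm

/-- Paired with any g, both sides give μ f(p) g(p). -/
theorem mul_hessClass (hp : IsIsolatedCriticalPoint F p) (f : LocalAlgebra hF) :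
    f * hessClass hF = evalAt hF hp f • hessClass hF := by
  refine residueForm_injective hF hp (LinearMap.ext fun g => ?_)
  rw [map_smul, LinearMap.smul_apply, residueForm_hessClass hF hp, smul_eq_mul, residueForm_apply,
    mul_right_comm, mul_comm, ← residueForm_apply, residueForm_hessClass hF hp, map_mul]
  ring

/-- An element that spans an ideal of dimension one is a multiple of the class of the Hessian. -/
theorem eq_smul_hessClass (hp : IsIsolatedCriticalPoint F p) {f : LocalAlgebra hF}
    (hf : ∀ φ, evalAt hF hp φ = 0 → φ * f = 0) :
    f = (localResidue hF f * (milnorNumber hF : ℂ)⁻¹) • hessClass hF := by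
  refine residueForm_injective hF hp (LinearMap.ext fun φ => ?_)
  -- Since φ - φ(p) annihilates f, the pairing (f, φ)_p is φ(p) ρ(f), proportional to the pairing of
  -- the Hessian class with φ.
  have h0 : evalAt hF hp (φ - algebraMap ℂ _ (evalAt hF hp φ)) = 0 := by
    rw [map_sub, AlgHom.commutes, Algebra.algebraMap_self_apply, sub_self]
  have h1 := hf _ h0
  rw [sub_mul, sub_eq_zero, ← Algebra.smul_def] at h1
  rw [map_smul, LinearMap.smul_apply, residueForm_hessClass hF hp, residueForm_apply, mul_comm f, h1,
    map_smul, smul_eq_mul, smul_eq_mul]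
  field_simp [milnorNumber_ne_zero hF hp]

theorem eq_smul_hessClass_of_eigenvector (hp : IsIsolatedCriticalPoint F p) {n : ℕ}
    {g : Fin n → LocalAlgebra hF} (hg : Algebra.adjoin ℂ (Set.range g) = ⊤)
    {f : LocalAlgebra hF} (hf : ∀ j, ∃ c : ℂ, g j * f = c • f) :
    ∃ c : ℂ, f = c • hessClass hF := by
  refine ⟨_, eq_smul_hessClass hF hp fun φ hφ => ?_⟩
  have hall : ∀ φ : LocalAlgebra hF, ∃ c : ℂ, φ * f = c • f := by
    intro φ
    have hφ : φ ∈ Algebra.adjoin ℂ (Set.range g) := hg ▸ Algebra.mem_top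
    induction hφ using Algebra.adjoin_induction with
    | mem x hx => obtain ⟨j, rfl⟩ := hx; exact hf j
    | algebraMap r => exact ⟨r, (Algebra.smul_def _ _).symm⟩
    | add x y _ _ hx hy =>
      obtain ⟨a, ha⟩ := hx
      obtain ⟨b, hb⟩ := hy
      exact ⟨a + b, by rw [add_mul, ha, hb, add_smul]⟩
    | mul x y _ _ hx hy =>
      obtain ⟨a, ha⟩ := hx
      obtain ⟨b, hb⟩ := hy
      exact ⟨b * a, by rw [mul_assoc, hb, mul_smul_comm, ha, smul_smul]⟩
  obtain ⟨c, hc⟩ := hall φ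
  obtain ⟨s, hs⟩ := isNilpotent_of_evalAt_eq_zero hF hp hφ
  -- A nilpotent φ can only act on f with eigenvalue c = 0, unless f = 0.
  have hpow : ∀ m : ℕ, φ ^ m * f = c ^ m • f := by
    intro m
    induction m with
    | zero => simp
    | succ m ih => rw [pow_succ, mul_assoc, hc, mul_smul_comm, ih, smul_smul, pow_succ']
  have h0 := hpow s
  rw [hs, zero_mul] at h0
  rcases smul_eq_zero.mp h0.symm with h | h
  · rw [hc, eq_zero_of_pow_eq_zero h, zero_smul]
  · rw [h, mul_zero]

/-! ### Bijectivity of α and the pulled back form -/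

theorem alphaMap_surjective (hp : IsIsolatedCriticalPoint F p)
    (h : Module.Basis ι ℂ (LocalAlgebra hF)) (w : ι → W) :
    Function.Surjective (alphaMap hF h w) := by
  classical
  have hle : spanY w ≤ LinearMap.range ((spanY w).subtype ∘ₗ alphaMap hF h w) := by
    rw [Submodule.span_le]
    rintro _ ⟨l, rfl⟩
    -- Duality supplies the element dual to h_l, which α sends to w_l.
    obtain ⟨f, hf⟩ := residueForm_surjective hF hp (h.coord l)
    refine ⟨f, ?_⟩
    rw [LinearMap.comp_apply, Submodule.subtype_apply, coe_alphaMap, hf]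
    simp [Finsupp.single_apply]
  intro y
  obtain ⟨f, hf⟩ := hle y.2
  exact ⟨f, Subtype.ext hf⟩

/-- The bilinear form induced by `S` on `A` is a multiple of the residue form by a unit. -/
theorem exists_isUnit_form_alphaMap (hp : IsIsolatedCriticalPoint F p) {n : ℕ}
    {g : Fin n → LocalAlgebra hF} (hg : Algebra.adjoin ℂ (Set.range g) = ⊤)
    {S : LinearMap.BilinForm ℂ W} {M : Fin n → Module.End ℂ W}
    (hM : ∀ j u v, S (M j u) v = S u (M j v)) {h : ι → LocalAlgebra hF} {w : ι → W}
    (hα : ∀ j f, M j (alphaMap hF h w f) = alphaMap hF h w (g j * f))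
    (hSw : ∑ l, ∑ m, S (w l) (w m) • (h l * h m) = (-1) ^ k * hessClass hF) :
    ∃ c : LocalAlgebra hF, IsUnit c ∧ ∀ f f',
      S (alphaMap hF h w f) (alphaMap hF h w f') = residueForm hF c (f * f') := by
  -- Here c represents the functional f ↦ S(α 1, α f).
  obtain ⟨c, hc⟩ := residueForm_surjective hF hp
    (S (alphaMap hF h w 1) ∘ₗ (spanY w).subtype ∘ₗ alphaMap hF h w)
  have hS : ∀ f f', S (alphaMap hF h w f) (alphaMap hF h w f') =
      residueForm hF c (f * f') := fun f f' => by
    rw [form_alphaMap hF hg hM hα, hc]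
    rfl
  refine ⟨c, isUnit_of_evalAt_ne_zero hF hp fun h0 => ?_, hS⟩
  -- The identity c f = ∑ ρ(h_l f) S(w_l, w_m) h_m, checked by pairing with f', computes the trace
  -- of c. If c(p) = 0 this trace vanishes, whereas the normalization of w makes it (-1)^k μ.
  have htr := milnorNumber_mul_evalAt_eq hF hp (c := c) (T := (Finset.univ : Finset (ι × ι)))
    (a := fun t => h t.1) (b := fun t => S (w t.1) (w t.2) • h t.2) (fun f => by
      refine residueForm_injective hF hp (LinearMap.ext fun f' => ?_)
      rw [residueForm_apply, mul_assoc, ← residueForm_apply, ← hS, coe_alphaMap, coe_alphaMap,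
        Fintype.sum_prod_type]
      simp only [map_sum, map_smul, LinearMap.sum_apply, LinearMap.smul_apply, smul_eq_mul,
        residueForm_apply, Finset.mul_sum]
      rw [Finset.sum_comm]
      refine Finset.sum_congr rfl fun l _ => Finset.sum_congr rfl fun m _ => ?_
      rw [mul_comm f (h _), mul_comm f' (h _)]
      ring)
  rw [h0, mul_zero, Fintype.sum_prod_type] at htr
  simp only [mul_smul_comm] at htr
  rw [hSw, mul_comm, ← residueForm_apply, residueForm_hessClass hF hp, map_pow, map_neg, map_one] at htr
  exact mul_ne_zero (milnorNumber_ne_zero hF hp) (pow_ne_zero _ (neg_ne_zero.mpr one_ne_zero))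
    htr.symm

/-- Coefficientwise, ([Hess F], h_l)_p = μ h_l(p). -/
theorem valueAt_eq (hp : IsIsolatedCriticalPoint F p) (h : ι → LocalAlgebra hF) (w : ι → W) :
    valueAt hF hp h w =
      (milnorNumber hF : ℂ)⁻¹ • (alphaMap hF h w (hessClass hF) : W) := by
  rw [valueAt_eq_sum, coe_alphaMap, Finset.smul_sum]
  refine Finset.sum_congr rfl fun l _ => ?_
  rw [residueForm_hessClass hF hp, smul_smul, inv_mul_cancel_left₀ (milnorNumber_ne_zero hF hp)]

end LocalAlgebra

/-- Transport along a linear bijection `e : A → Y` turns the multiplication of `A` into an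
isomorphism onto the algebra generated by operators `M_j|_Y` which `e` intertwines with the
multiplication by generators `g_j` of `A`. -/
theorem exists_algEquiv_restrictAlgebra {A W : Type*} [CommRing A] [Algebra ℂ A]
    [AddCommGroup W] [Module ℂ W] {n : ℕ} {g : Fin n → A}
    (hg : Algebra.adjoin ℂ (Set.range g) = ⊤) {M : Fin n → Module.End ℂ W} {Y : Submodule ℂ W}
    (hY : ∀ j, ∀ y ∈ Y, M j y ∈ Y) (e : A ≃ₗ[ℂ] Y)
    (he : ∀ j f, restrictOp hY j (e f) = e (g j * f)) :
    ∃ β : A ≃ₐ[ℂ] restrictAlgebra hY,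
      (∀ j, (β (g j)).1 = restrictOp hY j) ∧ ∀ f f', (β f).1 (e f') = e (f * f') := by
  let γ : A →ₐ[ℂ] Module.End ℂ Y :=
    (e.conjAlgEquiv ℂ).toAlgHom.comp (Algebra.lmul ℂ A)
  have hγ : ∀ f f', γ f (e f') = e (f * f') := fun f f' => by simp [γ]
  have hγg : ∀ j, γ (g j) = restrictOp hY j := fun j => LinearMap.ext fun y => by
    obtain ⟨f, rfl⟩ := e.surjective y
    rw [hγ, he]
  -- The regular representation is faithful: e 1 is a cyclic vector sent by γ f to e f.
  have hinj : Function.Injective γ := fun f f' h => by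
    have := DFunLike.congr_fun h (e 1)
    rwa [hγ, hγ, e.injective.eq_iff, mul_one, mul_one] at this
  have hrange : γ.range = restrictAlgebra hY := by
    rw [← Algebra.map_top, ← hg, AlgHom.map_adjoin, ← Set.range_comp, restrictAlgebra]
    congr 2
    exact funext hγg
  exact ⟨(AlgEquiv.ofInjective γ hinj).trans (Subalgebra.equivOfEq _ _ hrange), hγg, hγ⟩

end CriticalPoint

end

theorem mainTheorem3 {k n : ℕ} {p : Fin k → ℂ} {F : (Fin k → ℂ) → ℂ}
    (hF : AnalyticAt ℂ F p) (hp : CriticalPoint.IsIsolatedCriticalPoint F p)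
    (h : Module.Basis (Fin (CriticalPoint.milnorNumber hF)) ℂ (CriticalPoint.LocalAlgebra hF))
    (g : Fin n → CriticalPoint.LocalAlgebra hF)
    (hg : Algebra.adjoin ℂ (Set.range g) = ⊤)
    {W : Type*} [AddCommGroup W] [Module ℂ W]
    (S : LinearMap.BilinForm ℂ W) (hS : S.IsSymm)
    (M : Fin n → Module.End ℂ W)
    (hMcomm : ∀ i j, M i * M j = M j * M i)
    (hMsymm : ∀ j u v, S (M j u) v = S u (M j v))
    (w : Fin (CriticalPoint.milnorNumber hF) → W)
    (hMw : ∀ j, ∑ l, h l ⊗ₜ[ℂ] M j (w l) = ∑ l, (g j * h l) ⊗ₜ[ℂ] w l)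
    (hSw : ∑ l, ∑ m, S (w l) (w m) • (h l * h m) = (-1) ^ k * CriticalPoint.hessClass hF) :
    ∃ hY : ∀ j, ∀ y ∈ CriticalPoint.spanY w, M j y ∈ CriticalPoint.spanY w,
      Function.Bijective (CriticalPoint.alphaMap hF h w) ∧
      (S.restrict (CriticalPoint.spanY w)).Nondegenerate ∧
      (∃ β : CriticalPoint.LocalAlgebra hF ≃ₐ[ℂ] CriticalPoint.restrictAlgebra hY,
        (∀ j, (β (g j)).1 = CriticalPoint.restrictOp hY j) ∧
        (∀ γ : CriticalPoint.LocalAlgebra hF →ₐ[ℂ] CriticalPoint.restrictAlgebra hY,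
          (∀ j, (γ (g j)).1 = CriticalPoint.restrictOp hY j) → γ = β.toAlgHom) ∧
        (∀ f f' : CriticalPoint.LocalAlgebra hF,
          (β f).1 (CriticalPoint.alphaMap hF h w f') =
            CriticalPoint.alphaMap hF h w (f * f'))) ∧
      (∀ (j : Fin n) (f : CriticalPoint.LocalAlgebra hF),
        M j (CriticalPoint.alphaMap hF h w f) = CriticalPoint.alphaMap hF h w (g j * f)) ∧
      CriticalPoint.valueAt hF hp h w = (CriticalPoint.milnorNumber hF : ℂ)⁻¹ •
        (CriticalPoint.alphaMap hF h w (CriticalPoint.hessClass hF) : W) ∧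
      CriticalPoint.valueAt hF hp h w ≠ 0 ∧
      (∀ j, M j (CriticalPoint.valueAt hF hp h w) =
        CriticalPoint.evalAt hF hp (g j) • CriticalPoint.valueAt hF hp h w) ∧
      (∀ v : CriticalPoint.spanY w, v ≠ 0 →
        (∀ j, ∃ c : ℂ, CriticalPoint.restrictOp hY j v = c • v) →
        ∃ c : ℂ, (v : W) = c • CriticalPoint.valueAt hF hp h w) := by
  have hfin : Module.Finite ℂ (CriticalPoint.LocalAlgebra hF) := Module.Finite.of_basis h
  have hα := fun j f => CriticalPoint.apply_alphaMap hF (hMw j) f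
  have hsurj := CriticalPoint.alphaMap_surjective hF hp h w
  obtain ⟨c, hc, hS'⟩ := CriticalPoint.exists_isUnit_form_alphaMap hF hp hg hMsymm hα hSw
  -- The form (c, f f')_p is (c f, f')_p, so its kernel vanishes by duality and because c is a unit.
  have hker : ∀ f, (∀ f', CriticalPoint.residueForm hF c (f * f') = 0) → f = 0 := fun f hf => by
    refine hc.mul_right_eq_zero.mp (CriticalPoint.residueForm_injective hF hp ?_)
    refine LinearMap.ext fun f' => ?_
    rw [map_zero, LinearMap.zero_apply, ← hf f', CriticalPoint.residueForm_apply,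
      CriticalPoint.residueForm_apply, mul_assoc]
  -- If α f = 0 then S(α f, α f') = 0 for all f', so f is in the kernel of a nondegenerate form.
  have hinj : Function.Injective (CriticalPoint.alphaMap hF h w) := by
    rw [← LinearMap.ker_eq_bot, LinearMap.ker_eq_bot']
    intro f hf
    refine hker f fun f' => ?_
    rw [← hS', hf, Submodule.coe_zero, map_zero, LinearMap.zero_apply]
  have hY : ∀ j, ∀ y ∈ CriticalPoint.spanY w, M j y ∈ CriticalPoint.spanY w := fun j y hy => by
    obtain ⟨f, hf⟩ := hsurj ⟨y, hy⟩
    have hy' : y = CriticalPoint.alphaMap hF h w f := congrArg Subtype.val hf.symm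
    rw [hy', hα]
    exact Subtype.prop _
  have hαY : ∀ j f, CriticalPoint.restrictOp hY j (CriticalPoint.alphaMap hF h w f) =
      CriticalPoint.alphaMap hF h w (g j * f) := fun j f => Subtype.ext (hα j f)
  have hval := CriticalPoint.valueAt_eq hF hp (h : Fin _ → CriticalPoint.LocalAlgebra hF) w
  have hμ := CriticalPoint.milnorNumber_ne_zero hF hp
  obtain ⟨β, hβg, hβ⟩ := CriticalPoint.exists_algEquiv_restrictAlgebra hg hY
    (LinearEquiv.ofBijective _ ⟨hinj, hsurj⟩) hαY
  refine ⟨hY, ⟨hinj, hsurj⟩, ⟨fun y hy => ?_, fun y hy => ?_⟩, ⟨β, hβg, fun γ hγ => ?_, hβ⟩, hα,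
    hval, ?_, fun j => ?_, fun v hv hvM => ?_⟩
  · obtain ⟨f, rfl⟩ := hsurj y
    rw [hker f fun f' => by rw [← hS']; exact hy _, map_zero]
  · obtain ⟨f, rfl⟩ := hsurj y
    rw [hker f fun f' => by rw [mul_comm, ← hS']; exact hy _, map_zero]
  · refine AlgHom.ext_of_adjoin_eq_top hg ?_
    rintro _ ⟨j, rfl⟩
    exact Subtype.ext ((hγ j).trans (hβg j).symm)
  · rw [hval, Ne, smul_eq_zero_iff_right (inv_ne_zero hμ), Submodule.coe_eq_zero,
      map_eq_zero_iff _ hinj]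
    exact CriticalPoint.hessClass_ne_zero hF hp
  · rw [hval, map_smul, hα, CriticalPoint.mul_hessClass hF hp, map_smul, Submodule.coe_smul,
      smul_comm]
  · obtain ⟨f, rfl⟩ := hsurj v
    obtain ⟨a, ha⟩ := CriticalPoint.eq_smul_hessClass_of_eigenvector hF hp hg (f := f) fun j => by
      obtain ⟨b, hb⟩ := hvM j
      refine ⟨b, hinj ?_⟩
      rw [← hαY, hb, map_smul]
    -- The factor μ cancels the inverse in w(p) = α([Hess F]) / μ.
    refine ⟨a * CriticalPoint.milnorNumber hF, ?_⟩
    rw [hval, smul_smul, mul_assoc, mul_inv_cancel₀ hμ, mul_one, ha, map_smul, Submodule.coe_smul]
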